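/- **Setting.** Let $d\ge 1$, $c,\theta\in\mathbb R^d$, $\sigma>0$, let $A\in\mathbb R^{d\times d}$ be symmetric positive definite, and write $\|u\|_M=\sqrt{u^\top M u}$. The action set is the ellipsoid $\mathcal X=\{x\in\mathbb R^d:\|x-c\|_{A^{-1}}\le 1\}$. In each round $t=1,\dots,T$ a learner chooses $x_t\in\mathcal X$ on the basis of $y_1,\dots,y_{t-1}$ and then observes $y_t=x_t^\top\theta+z_t$, where the noise variables $z_t$ are independent, centered and subgaussian with variance proxy $\sigma^2$, i.e. $\mathbb E[e^{\lambda z_t}]\le e^{\lambda^2\sigma^2/2}$ for all $\lambda\in\mathbb R$. The regret is $R_T(\theta)=\mathbb E\big[\sum_{t=1}^T (x^\star-x_t)^\top\theta\big]$ with $x^\star\in\arg\max_{x\in\mathcal X}x^\top\theta$. **Centered algorithm.** $\mathrm{E2TC}(s,H)$, with noise level $s>0$, horizon $H$ (a real number) and threshold parameter $\alpha=3$, plays in $\mathcal X_0=\{x:\|x\|_{A^{-1}}\le 1\}$; its rounds are numbered from $0$. In the two exploration phases it plays $A^{1/2}e_{(t\bmod d)+1}$ in round $t$. 1. *Warm-up.*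 For $i\ge 1$ let $n_i=d2^{i-1}$, $T_i=d(2^i-1)$ (so $T_0=0$), $\delta_i=\min(dn_i/H,1)$, and let $U_i\ge 0$ be given by $$U_i^2=\frac{s^2d^2}{n_i}\Big(1+2\sqrt{\tfrac1d\log\tfrac1{\delta_i}}+\tfrac2d\log\tfrac1{\delta_i}\Big).$$ Let $\hat\theta_i$ be the ordinary least-squares estimate of $\theta$ from the observations of rounds $T_{i-1}\le t<T_i$. Warm-up ends after the block with the first index $i\ge1$ such that $\|\hat\theta_i\|_A>3U_i$; put $\hat B=\|\hat\theta_i\|_A$ for this $i$. 2. *Exploration.* With $N_e=d\lceil s\sqrt H/\hat B\rceil$, explore in rounds $T_i\le t<T_i+N_e$, and let $\hat\theta$ be the least-squares estimate from these rounds. 3. *Commit.* From then on, play a fixed element of $\arg\max_{x\in\mathcal X_0}x^\top\hat\theta$ for ever, chosen by an arbitrary rule depending only on $\hat\theta$. **Reduction.** On $\mathcal X$, run $\mathrm{E2TC}(\sqrt2\,\sigma,T/2)$ (variance proxy $2\sigma^2$, horizon $T/2$) as follows: each exploration action $\tilde x$ is replaced by two consecutive rounds in which $c$ and then $c+\tilde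 x$ are played, and the centered algorithm is given the second reward minus the first one as its observation; when it commits to $x_{\mathrm{commit}}$, play $c+x_{\mathrm{commit}}$ in all remaining rounds. Play stops after $T$ rounds, in whichever phase the algorithm then is. **Theorem.** For every ellipsoid $\mathcal X$ as above, every $\theta\in\mathbb R^d$ and every integer $T\ge 0$, the regret of this algorithm satisfies $$R_T(\theta)\le 7d\sigma\sqrt T+\frac{2622\,\sigma^2d^2}{\|\theta\|_A}\,\overline{\log}\Big(\frac{T\|\theta\|_A^2}{4\sigma^2d^2}\Big)+2T\|\theta\|_A\exp\Big(\min\Big\{\frac{2d}3-\frac{\sqrt T\,\|\theta\|_A}{9\sigma},\,0\Big\}\Big)+392\,d\,\|\theta\|_A,$$ where $\overline{\log}(x)=1+\log\max(x,1)$, and for $\theta=0$ the second term is read as $0$ (the regret is then $0$). -/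

import Mathlib

open MeasureTheory ProbabilityTheory Matrix
open scoped NNReal MatrixOrder

noncomputable section

namespace EllipsoidBandit

variable {d : ℕ}

/-! ### Norms, ellipsoids, optimal actions -/

/-- The norm `‖u‖_M = √(uᵀ M u)` of a positive definite matrix `M`. -/
def matNorm (M : Matrix (Fin d) (Fin d) ℝ) (u : Fin d → ℝ) : ℝ :=
  Real.sqrt (u ⬝ᵥ (M *ᵥ u))

/-- The ellipsoid `{x : ‖x - c‖_{A⁻¹} ≤ 1}`. -/
def ellipsoid (c : Fin d → ℝ) (A : Matrix (Fin d) (Fin d) ℝ) : Set (Fin d → ℝ) :=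
  {x | matNorm A⁻¹ (x - c) ≤ 1}

/-- `x` is a maximizer of `y ↦ yᵀ v` over `X`, that is, `x ∈ argmax_{y ∈ X} yᵀ v`. -/
def IsArgmax (X : Set (Fin d → ℝ)) (v x : Fin d → ℝ) : Prop :=
  x ∈ X ∧ ∀ y ∈ X, y ⬝ᵥ v ≤ x ⬝ᵥ v

/-- `1 + log (max x 1)`. -/
def logBar (x : ℝ) : ℝ := 1 + Real.log (max x 1)

/-! ### Interaction of a policy with a linear bandit

Rounds are numbered from `0`. -/

/-- The first `t` entries of a sequence of observations; later entries are erased. -/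
def past (t : ℕ) (y : ℕ → ℝ) : ℕ → ℝ := fun s => if s < t then y s else 0

/-- A (deterministic) policy: `π t y` is the action of round `t` when `y` is the sequence of
rewards of the earlier rounds. A policy is only ever run on truncated sequences `past t y`. -/
abbrev Policy (d : ℕ) := ℕ → (ℕ → ℝ) → (Fin d → ℝ)

/-- The reward `y_t = x_tᵀ θ + z_t` when `π` plays against the parameter `θ` and noise `z`. -/
def reward (π : Policy d) (θ : Fin d → ℝ) (z : ℕ → ℝ) (t : ℕ) : ℝ :=
  π t (fun s => if _ : s < t then reward π θ z s else 0) ⬝ᵥ θ + z t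
termination_by t

/-- The action `x_t` that `π` plays in round `t`, as a function of the rewards before `t`. -/
def action (π : Policy d) (θ : Fin d → ℝ) (z : ℕ → ℝ) (t : ℕ) : Fin d → ℝ :=
  π t (past t (reward π θ z))

/-- `∑_{t < T} (x⋆ᵀ θ - x_tᵀ θ)` along the noise sequence `z`. -/
def pathRegret (π : Policy d) (θ xopt : Fin d → ℝ) (T : ℕ) (z : ℕ → ℝ) : ℝ :=
  ∑ t ∈ Finset.range T, (xopt ⬝ᵥ θ - action π θ z t ⬝ᵥ θ)

/-! ### Explore-then-commit algorithms and the reduction for translated action sets -/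

/-- An explore-then-commit algorithm. After `t` observations `y`, it is told by `done t y` whether
exploration is over; if it is not, the next action is `explore t y`, and at the first `t` at
which it is over, the algorithm commits to the action `commit t y` for ever. -/
structure ETCAlgorithm (d : ℕ) where
  done : ℕ → (ℕ → ℝ) → Prop
  explore : ℕ → (ℕ → ℝ) → (Fin d → ℝ)
  commit : ℕ → (ℕ → ℝ) → (Fin d → ℝ)

/-- The observation handed to the underlying algorithm after the `s`-th pair of rounds: the
reward of the translated exploration action minus the reward of the reference point. -/
def pairDiff (y : ℕ → ℝ) (s : ℕ) : ℝ := y (2 * s + 1) - y (2 * s)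

open Classical in
/-- The reduction for the action set translated by `c`: while `𝒜` explores, its exploration
action `x̃` is replaced by two rounds, in which `c` and then `c + x̃` are played, and `𝒜` receives
the difference of the two rewards. Once `𝒜` commits to `x`, the action `c + x` is played. -/
def translated (𝒜 : ETCAlgorithm d) (c : Fin d → ℝ) : Policy d := fun t y =>
  if h : ∃ j, j ≤ t / 2 ∧ 𝒜.done j (past j (pairDiff y)) then
    c + 𝒜.commit (Nat.find h) (past (Nat.find h) (pairDiff y))
  else if t % 2 = 0 then c
  else c + 𝒜.explore (t / 2) (past (t / 2) (pairDiff y))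

/-! ### The algorithm E2TC for the centered ellipsoid -/

/-- Ordinary least squares `(Xᵀ X)⁻¹ Xᵀ Y`. -/
def leastSquares {ι : Type*} [Fintype ι] (X : Matrix ι (Fin d) ℝ) (Y : ι → ℝ) : Fin d → ℝ :=
  (Xᵀ * X)⁻¹ *ᵥ (Xᵀ *ᵥ Y)

/-- The round-robin exploration action `A^{1/2} e_{t mod d}` (coordinates numbered from `0`),
with the positive semidefinite square root. -/
def roundRobin [NeZero d] (A : Matrix (Fin d) (Fin d) ℝ) (t : ℕ) : Fin d → ℝ :=
  CFC.sqrt A *ᵥ Pi.single (Fin.ofNat d t) 1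

/-- Least-squares estimate of `θ` from the round-robin observations of rounds `a ≤ t < b`. -/
def estimate [NeZero d] (A : Matrix (Fin d) (Fin d) ℝ) (a b : ℕ) (y : ℕ → ℝ) : Fin d → ℝ :=
  leastSquares (Matrix.of fun t : Finset.Ico a b => roundRobin A t)
    (fun t : Finset.Ico a b => y t)

/-- `n_i = d 2^{i-1}` for `i ≥ 1`, the length of the `i`-th warm-up block. -/
def blockLength (d i : ℕ) : ℕ := d * 2 ^ (i - 1)

/-- `T_i = d (2^i - 1)`; the `i`-th warm-up block, `i ≥ 1`, is the rounds `T_{i-1} ≤ t < T_i`. -/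
def blockEnd (d i : ℕ) : ℕ := d * (2 ^ i - 1)

/-- `δ_i = min (d n_i / T) 1`, for a real horizon `T`. -/
def blockDelta (d : ℕ) (T : ℝ) (i : ℕ) : ℝ := min (d * blockLength d i / T) 1

/-- `U(δ, n)`, defined by
`U(δ, n)² = (σ² d² / n) (1 + 2 √((1/d) log (1/δ)) + (2/d) log (1/δ))`. -/
def confRadius (d : ℕ) (σ δ : ℝ) (n : ℕ) : ℝ :=
  Real.sqrt (σ ^ 2 * (d : ℝ) ^ 2 / n *
    (1 + 2 * Real.sqrt (1 / d * Real.log (1 / δ)) + 2 / d * Real.log (1 / δ)))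

/-- The norm `‖θ̂_i‖_A` of the estimate from the `i`-th warm-up block. -/
def blockNorm [NeZero d] (A : Matrix (Fin d) (Fin d) ℝ) (y : ℕ → ℝ) (i : ℕ) : ℝ :=
  matNorm A (estimate A (blockEnd d (i - 1)) (blockEnd d i) y)

/-- Warm-up ends after block `i`: this is the first block, `i ≥ 1`, with
`‖θ̂_i‖_A > α U(δ_i, n_i)`. -/
def WarmupEnds [NeZero d] (A : Matrix (Fin d) (Fin d) ℝ) (α σ T : ℝ) (y : ℕ → ℝ) (i : ℕ) : Prop :=
  IsLeast {i : ℕ | 1 ≤ i ∧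
    α * confRadius d σ (blockDelta d T i) (blockLength d i) < blockNorm A y i} i

/-- The length `N_e = d ⌈σ √T / B̂⌉` of the second exploration phase. -/
def exploreLength (d : ℕ) (σ T B : ℝ) : ℕ := d * ⌈σ * Real.sqrt T / B⌉₊

/-- The second exploration phase is the rounds `T_i ≤ t < T_i + N_e`, where `i` is the last
warm-up block; this is the round `T_i + N_e` at which it is over. -/
def exploreEnd [NeZero d] (A : Matrix (Fin d) (Fin d) ℝ) (σ T : ℝ) (y : ℕ → ℝ) (i : ℕ) : ℕ :=
  blockEnd d i + exploreLength d σ T (blockNorm A y i)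

open Classical in
/-- E2TC for the centered ellipsoid of matrix `A`, with noise level `σ`, (real) horizon `T`,
threshold parameter `α`, and a rule `xs` with `xs v ∈ argmax_{x} xᵀ v`. Both exploration phases
play round-robin; after the second one, the algorithm commits to `xs θ̂`, where `θ̂` is the
least-squares estimate from the second phase. -/
def e2tc [NeZero d] (A : Matrix (Fin d) (Fin d) ℝ) (xs : (Fin d → ℝ) → (Fin d → ℝ))
    (α σ T : ℝ) : ETCAlgorithm d where
  done t y := ∃ i, WarmupEnds A α σ T y i ∧ exploreEnd A σ T y i ≤ t
  explore t _ := roundRobin A t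
  commit _ y :=
    if h : ∃ i, WarmupEnds A α σ T y i then
      xs (estimate A (blockEnd d h.choose) (exploreEnd A σ T y h.choose) y)
    else 0

/-- E2TC for the ellipsoid of center `c` and matrix `A`, noise level `σ` and horizon `T`: the
reduction applied to centered E2TC tuned with variance proxy `2 σ²` (noise level `√2 σ`) and
horizon `T / 2`. -/
def translatedE2TC [NeZero d] (c : Fin d → ℝ) (A : Matrix (Fin d) (Fin d) ℝ)
    (xs : (Fin d → ℝ) → (Fin d → ℝ)) (α σ T : ℝ) : Policy d :=
  translated (e2tc A xs α (Real.sqrt 2 * σ) (T / 2)) c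

end EllipsoidBandit

end

namespace EllipsoidBandit

/-! In the coordinates given by `A^{1/2}` the ellipsoid is the Euclidean unit ball and `θ` becomes a
vector `w` of norm `m = ‖θ‖_A`. Differences of paired rewards remove the centre and double the
variance proxy. Least squares over `k` round-robin cycles is then a coordinatewise average, `w` plus
a noise vector with variance proxy `2σ²/k` (`sqrt_mulVec_estimate`, `subgaussianVec_avg`).

The ball is curved, so committing on an estimate with error `e`, `|e| < m`, costs at most `|e|²/m`
per round rather than `|e|` (`commitRegret_le`). With `k` cycles, exploration costs at most `3mdk`
and the commit phase about `2Tdσ²/(km)`, plus a term for the unlikely event `|e| ≥ m`. The best `k`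
is of order `σ√T/m`. Since `m` is unknown, `k` is computed from the warm-up estimate `B̂`, and any
`B̂` between `m/2` and `33m/20` gives `7dσ√T` (`exploreCommit_cost_le`).

It remains to pay for the warm-up. Let `q = 2σ²d²/m²`, the block length at which noise and signal
are comparable. Three costs are separated in `pathRegret_le`.

Length of the warm-up (`sum_warmup_le`): the confidence radius exceeds `m/4` only for blocks of
length `O(q logBar)`, whose total is geometric. For a longer block of length `n` the probability of
not stopping is `O(q/n)` by Markov's inequality, so each such block costs `O(mq)`, and there are
logarithmically many.

Stopping with a wrong `B̂` (`sum_badEnd_le`): the error must then exceed the radius by a margin,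
which has probability at most `δ_i exp(-const · d n_i / q)`. The factor `δ_i`, proportional to
`n_i/T`, cancels the regret `2mT`, and the exponential makes the sum over doubling blocks `O(mq)`.

Stopping with a good `B̂` (`sum_goodEnd_le`): the second-phase estimate is independent of the
warm-up, so the cost is averaged separately on each event that fixes the last block `i` and the
number `k` of cycles. -/

/-! ### Subgaussian random vectors -/

section SubgaussianVector

variable {Ω ι : Type*} [MeasurableSpace Ω] [Fintype ι]

/-- A random vector all of whose linear functionals satisfy the subgaussian moment bound with
variance proxy `v` times the squared Euclidean norm of the functional. -/
def SubgaussianVec (μ : Measure Ω) (v : ℝ) (X : Ω → ι → ℝ) : Prop :=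
  ∀ u : ι → ℝ, ∫⁻ ω, ENNReal.ofReal (Real.exp (∑ j, u j * X ω j)) ∂μ ≤
    ENNReal.ofReal (Real.exp (v * (∑ j, u j ^ 2) / 2))

lemma gaussian_exp_sq {b : ℝ} (hb : b < 1 / 2) :
    Integrable (fun g : ℝ => Real.exp (b * g ^ 2)) (gaussianReal 0 1) ∧
      ∫ g, Real.exp (b * g ^ 2) ∂gaussianReal 0 1 = (1 - 2 * b) ^ (-(1 / 2) : ℝ) := by
  have hp : (0 : ℝ) < 1 / 2 - b := by linarith
  have hpi := Real.pi_pos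
  have e : ∀ g : ℝ, gaussianPDFReal 0 1 g • Real.exp (b * g ^ 2)
      = (√(2 * Real.pi))⁻¹ * Real.exp (-(1 / 2 - b) * g ^ 2) := by
    intro g
    rw [gaussianPDFReal, smul_eq_mul, mul_assoc, ← Real.exp_add]
    simp only [NNReal.coe_one, mul_one, sub_zero]
    congr 2
    ring
  constructor
  · rw [gaussianReal_of_var_ne_zero _ one_ne_zero]
    rw [integrable_withDensity_iff_integrable_smul₀' (by fun_prop) (by simp [gaussianPDF])]
    have : (fun g : ℝ => (gaussianPDF 0 1 g).toReal • Real.exp (b * g ^ 2))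
        = fun g => (√(2 * Real.pi))⁻¹ * Real.exp (-(1 / 2 - b) * g ^ 2) := by
      funext g
      rw [toReal_gaussianPDF, e]
    rw [this]
    exact (integrable_exp_neg_mul_sq hp).const_mul _
  · rw [integral_gaussianReal_eq_integral_smul one_ne_zero]
    simp_rw [e]
    rw [integral_const_mul, integral_gaussian, ← Real.sqrt_inv, ← Real.sqrt_mul (by positivity),
      Real.rpow_neg (by linarith), ← Real.sqrt_eq_rpow, ← Real.sqrt_inv]
    congr 1
    have : (1 - 2 * b) ≠ 0 := by linarith
    field_simp
    try ring

/-- Gaussian linearization: if `X` is subgaussian with variance proxy `v`, then `‖X‖²` has the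
exponential moments of `v` times a `χ²` variable. -/
lemma SubgaussianVec.lintegral_exp_sq_le {μ : Measure Ω} [SFinite μ] {v : ℝ} {X : Ω → ι → ℝ}
    (hX : SubgaussianVec μ v X) (hm : Measurable X) {l : ℝ} (hl : 0 ≤ l) (hlv : 2 * l * v < 1) :
    ∫⁻ ω, ENNReal.ofReal (Real.exp (l * ∑ j, X ω j ^ 2)) ∂μ ≤
      ENNReal.ofReal ((1 - 2 * l * v) ^ (-(Fintype.card ι / 2) : ℝ)) := by
  set γ : Measure (ι → ℝ) := Measure.pi fun _ => gaussianReal 0 1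
  set r := √(2 * l) with hr
  have hr2 : r ^ 2 = 2 * l := Real.sq_sqrt (by linarith)
  -- For fixed `x`, `exp (l‖x‖²)` is the Gaussian average of `exp (√(2l) g·x)`. After Tonelli only
  -- linear functionals of `X` remain, and their bounds are integrated against the Gaussian.
  have h1 : ∀ x : ι → ℝ, ENNReal.ofReal (Real.exp (l * ∑ j, x j ^ 2)) =
      ∫⁻ g, ENNReal.ofReal (Real.exp (∑ j, (r * g j) * x j)) ∂γ := by
    intro x
    have e : ∀ g : ι → ℝ, Real.exp (∑ j, (r * g j) * x j) = ∏ j, Real.exp ((r * x j) * g j) := by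
      intro g
      rw [Real.exp_sum]
      exact Finset.prod_congr rfl fun j _ => by ring_nf
    simp_rw [e]
    rw [← ofReal_integral_eq_lintegral_ofReal]
    · rw [integral_fintype_prod_eq_prod (fun j (y : ℝ) => Real.exp ((r * x j) * y))]
      have : ∀ t : ℝ, ∫ y, Real.exp (t * y) ∂gaussianReal 0 1 = Real.exp (t ^ 2 / 2) := by
        intro t
        have := congrFun (mgf_fun_id_gaussianReal (μ := 0) (v := 1)) t
        simpa [mgf] using this
      simp_rw [this]
      rw [← Real.exp_sum, Finset.mul_sum]
      congr 2
      refine Finset.sum_congr rfl fun j _ => ?_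
      rw [mul_pow, hr2]
      ring
    · exact Integrable.fintype_prod (f := fun j (y : ℝ) => Real.exp ((r * x j) * y))
        fun j => integrable_exp_mul_gaussianReal _
    · exact Filter.Eventually.of_forall fun g => Finset.prod_nonneg fun j _ => (Real.exp_pos _).le
  simp_rw [h1]
  rw [lintegral_lintegral_swap (by fun_prop)]
  calc _ ≤ ∫⁻ g, ENNReal.ofReal (∏ j, Real.exp ((l * v) * g j ^ 2)) ∂γ := by
        refine lintegral_mono fun g => (hX _).trans (ENNReal.ofReal_le_ofReal (le_of_eq ?_))
        rw [← Real.exp_sum, ← Finset.mul_sum]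
        congr 1
        simp_rw [mul_pow, hr2, ← Finset.mul_sum]
        ring
    _ = ENNReal.ofReal ((1 - 2 * l * v) ^ (-(Fintype.card ι / 2) : ℝ)) := by
        have hb : l * v < 1 / 2 := by linarith
        rw [← ofReal_integral_eq_lintegral_ofReal]
        · rw [integral_fintype_prod_eq_prod (fun j (y : ℝ) => Real.exp ((l * v) * y ^ 2))]
          simp_rw [(gaussian_exp_sq hb).2]
          rw [Finset.prod_const, Finset.card_univ, ← Real.rpow_natCast, ← Real.rpow_mul
            (by linarith)]
          congr 2 <;> ring
        · exact Integrable.fintype_prod (f := fun j (y : ℝ) => Real.exp ((l * v) * y ^ 2))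
            fun j => (gaussian_exp_sq hb).1
        · exact Filter.Eventually.of_forall fun g =>
            Finset.prod_nonneg fun j _ => (Real.exp_pos _).le

/-- First-order expansion of the exponential moment at `0`: `1 + y ≤ exp y` gives `1 + l E‖X‖² ≤ (1
- x) ^ (-D/2)` with `x = 2lv`. Subtracting `1`, dividing by `l` and letting `x → 0` leaves `D v`. -/
lemma SubgaussianVec.lintegral_sq_le {μ : Measure Ω} [IsProbabilityMeasure μ] {v : ℝ}
    (hv : 0 < v) {X : Ω → ι → ℝ} (hX : SubgaussianVec μ v X) (hm : Measurable X) :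
    ∫⁻ ω, ENNReal.ofReal (∑ j, X ω j ^ 2) ∂μ ≤ ENNReal.ofReal (Fintype.card ι * v) := by
  set D : ℝ := (Fintype.card ι : ℝ)
  have hD : 0 ≤ D := Nat.cast_nonneg _
  set F : ℝ → ℝ := fun x => D * v / (1 - x) * Real.exp (D / 2 * (x / (1 - x)))
  have key : ∀ x : ℝ, 0 < x → x < 1 →
      ∫⁻ ω, ENNReal.ofReal (∑ j, X ω j ^ 2) ∂μ ≤ ENNReal.ofReal (F x) := by
    intro x hx0 hx1
    set l := x / (2 * v)
    have hl : 0 < l := by positivity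
    have hlv : 2 * l * v = x := by simp only [l]; field_simp
    have h := hX.lintegral_exp_sq_le hm hl.le (by rw [hlv]; exact hx1)
    rw [hlv] at h
    have h2 : 1 + ENNReal.ofReal l * ∫⁻ ω, ENNReal.ofReal (∑ j, X ω j ^ 2) ∂μ ≤
        ENNReal.ofReal ((1 - x) ^ (-(D / 2) : ℝ)) := by
      refine le_trans (le_of_eq ?_) (le_trans (lintegral_mono (f := fun ω =>
        1 + ENNReal.ofReal l * ENNReal.ofReal (∑ j, X ω j ^ 2)) fun ω => ?_) h)
      · rw [lintegral_add_left measurable_const, lintegral_const_mul _ (by fun_prop)]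
        simp
      · have hs : 0 ≤ ∑ j, X ω j ^ 2 := Finset.sum_nonneg fun j _ => sq_nonneg _
        show 1 + ENNReal.ofReal l * ENNReal.ofReal (∑ j, X ω j ^ 2) ≤ _
        rw [← ENNReal.ofReal_mul hl.le, ← ENNReal.ofReal_one, ← ENNReal.ofReal_add zero_le_one
          (by positivity)]
        refine ENNReal.ofReal_le_ofReal ?_
        linarith [Real.add_one_le_exp (l * ∑ j, X ω j ^ 2)]
    set I := ∫⁻ ω, ENNReal.ofReal (∑ j, X ω j ^ 2) ∂μ
    have hI : I ≠ ⊤ := by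
      intro hI
      rw [hI, ENNReal.mul_top (by simpa using hl)] at h2
      simp at h2
    rw [← ENNReal.ofReal_toReal hI]
    refine ENNReal.ofReal_le_ofReal ?_
    have h3 : 1 + l * I.toReal ≤ (1 - x) ^ (-(D / 2) : ℝ) := by
      rw [← ENNReal.ofReal_toReal hI, ← ENNReal.ofReal_mul hl.le, ← ENNReal.ofReal_one,
        ← ENNReal.ofReal_add zero_le_one (by positivity)] at h2
      exact (ENNReal.ofReal_le_ofReal_iff (Real.rpow_nonneg (by linarith) _)).1 h2
    have hx' : 0 < 1 - x := by linarith
    set y := D / 2 * (x / (1 - x))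
    have h4 : (1 - x) ^ (-(D / 2) : ℝ) ≤ Real.exp y := by
      rw [Real.rpow_def_of_pos hx', Real.exp_le_exp]
      have := Real.one_sub_inv_le_log_of_pos hx'
      have e : x / (1 - x) = (1 - x)⁻¹ - 1 := by field_simp; ring
      simp only [y, e]
      nlinarith
    have h5 : Real.exp y - 1 ≤ y * Real.exp y := by
      have := Real.add_one_le_exp (-y)
      have e : Real.exp (-y) * Real.exp y = 1 := by rw [← Real.exp_add]; simp
      nlinarith [Real.exp_pos y]
    have h6 : l * I.toReal ≤ l * F x := by
      have : l * F x = y * Real.exp y := by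
        simp only [F, l, y]
        field_simp
      linarith
    exact le_of_mul_le_mul_left h6 hl
  have hF : Filter.Tendsto (fun x => ENNReal.ofReal (F x)) (nhdsWithin 0 (Set.Ioi 0))
      (nhds (ENNReal.ofReal (D * v))) := by
    refine (ENNReal.tendsto_ofReal ?_).mono_left nhdsWithin_le_nhds
    have : ContinuousAt F 0 := by
      have h1 : (1 : ℝ) - 0 ≠ 0 := by norm_num
      fun_prop (disch := exact h1)
    simpa [F] using this.tendsto
  refine ge_of_tendsto hF ?_
  filter_upwards [Ioo_mem_nhdsGT (zero_lt_one' ℝ)] with x hx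
  exact key x hx.1 hx.2

/-- Chernoff bound for the squared norm of a subgaussian vector. -/
lemma SubgaussianVec.measureReal_le {μ : Measure Ω} [IsProbabilityMeasure μ] {v : ℝ}
    {X : Ω → ι → ℝ} (hX : SubgaussianVec μ v X) (hm : Measurable X) {l : ℝ} (hl : 0 ≤ l)
    (hlv : 2 * l * v < 1) (y : ℝ) :
    μ.real {ω | y ≤ ∑ j, X ω j ^ 2} ≤
      Real.exp (-(l * y)) * (1 - 2 * l * v) ^ (-(Fintype.card ι / 2) : ℝ) := by
  have h := hX.lintegral_exp_sq_le hm hl hlv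
  have h1 := meas_ge_le_lintegral_div (μ := μ)
    (f := fun ω => ENNReal.ofReal (Real.exp (l * ∑ j, X ω j ^ 2))) (by fun_prop)
    (ε := ENNReal.ofReal (Real.exp (l * y))) (by simp [Real.exp_pos]) (by simp)
  have h0 : (0 : ℝ) ≤ (1 - 2 * l * v) ^ (-(Fintype.card ι / 2) : ℝ) :=
    Real.rpow_nonneg (by linarith) _
  have h2 : μ {ω | y ≤ ∑ j, X ω j ^ 2} ≤
      ENNReal.ofReal (Real.exp (-(l * y)) * (1 - 2 * l * v) ^ (-(Fintype.card ι / 2) : ℝ)) := by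
    calc _ ≤ _ := measure_mono fun ω hω => ?_
      _ ≤ _ := h1
      _ ≤ _ := ENNReal.div_le_div_right h _
      _ = _ := ?_
    · exact ENNReal.ofReal_le_ofReal (Real.exp_le_exp.2 (mul_le_mul_of_nonneg_left hω hl))
    · rw [← ENNReal.ofReal_div_of_pos (Real.exp_pos _), Real.exp_neg, div_eq_inv_mul]
  rw [Measure.real]
  exact ENNReal.toReal_le_of_le_ofReal (by positivity) h2

/-- This is half of `u ≤ sinh u` at `u = -log (1 - 2t)`. -/
lemma neg_half_log_sub_le {t : ℝ} (ht : 0 ≤ t) (ht' : t < 1 / 2) :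
    -(1 / 2) * Real.log (1 - 2 * t) ≤ t + t ^ 2 / (1 - 2 * t) := by
  have hu : 0 < 1 - 2 * t := by linarith
  have h := Real.self_le_sinh_iff (x := -Real.log (1 - 2 * t)) |>.2
    (by linarith [Real.log_nonpos hu.le (by linarith)])
  rw [Real.sinh_eq, neg_neg, Real.exp_neg, Real.exp_log hu] at h
  have e : t + t ^ 2 / (1 - 2 * t) = ((1 - 2 * t)⁻¹ - (1 - 2 * t)) / 4 := by
    obtain ⟨u, rfl⟩ : ∃ u, t = (1 - u) / 2 := ⟨1 - 2 * t, by ring⟩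
    have e' : 1 - 2 * ((1 - u) / 2) = u := by ring
    rw [e'] at hu ⊢
    field_simp
    ring
  rw [e]
  linarith

/-- The Laurent-Massart type tail bound of Hsu, Kakade and Zhang. -/
lemma SubgaussianVec.tail_le {μ : Measure Ω} [IsProbabilityMeasure μ] {v : ℝ} (hv : 0 < v)
    {X : Ω → ι → ℝ} (hX : SubgaussianVec μ v X) (hm : Measurable X) [Nonempty ι]
    {x : ℝ} (hx : 0 ≤ x) :
    μ.real {ω | v * (Fintype.card ι + 2 * √(Fintype.card ι * x) + 2 * x) ≤ ∑ j, X ω j ^ 2} ≤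
      Real.exp (-x) := by
  set D : ℝ := (Fintype.card ι : ℝ) with hDdef
  have hD : 0 < D := by rw [hDdef]; exact_mod_cast Fintype.card_pos
  set p := √D with hp
  set r := √x with hr
  have hp0 : 0 < p := Real.sqrt_pos.2 hD
  have hr0 : 0 ≤ r := Real.sqrt_nonneg _
  have hp2 : p ^ 2 = D := Real.sq_sqrt hD.le
  have hr2 : r ^ 2 = x := Real.sq_sqrt hx
  -- The minimizer of `D (t + t²/(1-2t)) - t y` at `y = D + 2√(Dx) + 2x`; the minimum is exactly
  -- `-x`.
  set t := r / (p + 2 * r) with ht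
  have hq : 0 < p + 2 * r := by positivity
  have ht0 : 0 ≤ t := by positivity
  have h12 : 1 - 2 * t = p / (p + 2 * r) := by simp only [t]; field_simp; ring
  have h12' : 0 < 1 - 2 * t := by rw [h12]; positivity
  have ht' : t < 1 / 2 := by linarith
  have e : 2 * (t / v) * v = 2 * t := by field_simp
  have h := hX.measureReal_le hm (l := t / v) (by positivity) (by rw [e]; linarith)
    (v * (D + 2 * √(D * x) + 2 * x))
  rw [e, Real.rpow_def_of_pos h12', ← Real.exp_add] at h
  refine h.trans (Real.exp_le_exp.2 ?_)
  have h1 := neg_half_log_sub_le ht0 ht'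
  rw [Real.sqrt_mul hD.le, ← hp, ← hr, ← hp2, ← hr2]
  have e2 : t / v * (v * (p ^ 2 + 2 * (p * r) + 2 * r ^ 2)) =
      t * (p ^ 2 + 2 * (p * r) + 2 * r ^ 2) := by field_simp
  rw [e2]
  have e3 : t * (p ^ 2 + 2 * (p * r) + 2 * r ^ 2) = p ^ 2 * (t + t ^ 2 / (1 - 2 * t)) + r ^ 2 := by
    rw [h12]
    simp only [t]
    field_simp
    ring
  rw [e3, ← hDdef, ← hp2]
  nlinarith [mul_le_mul_of_nonneg_left h1 (sq_nonneg p)]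

/-- Chernoff bound at `l = 11/(30v)`, where `1 - 2lv = 4/15`; `log (15/4) ≤ 4/3` produces `2D/3`.
The rate `11/30` leads to the final rate `1/9 = 11/60 · 20/33`, where `33/20` is the allowed
overestimate of `‖θ‖_A`. -/
lemma SubgaussianVec.norm_tail_le {μ : Measure Ω} [IsProbabilityMeasure μ] {v : ℝ} (hv : 0 < v)
    {X : Ω → ι → ℝ} (hX : SubgaussianVec μ v X) (hm : Measurable X) (m : ℝ) :
    μ.real {ω | m ^ 2 ≤ ∑ j, X ω j ^ 2} ≤
      Real.exp (min (2 * Fintype.card ι / 3 - 11 / 30 * m ^ 2 / v) 0) := by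
  rcases min_choice (2 * (Fintype.card ι : ℝ) / 3 - 11 / 30 * m ^ 2 / v) 0 with h | h
  swap
  · rw [h]
    simp
  rw [h]
  have e : 2 * (11 / 30 / v) * v = 11 / 15 := by field_simp; norm_num
  have h := hX.measureReal_le hm (l := 11 / 30 / v) (by positivity) (by rw [e]; norm_num) (m ^ 2)
  rw [e, Real.rpow_def_of_pos (by norm_num), ← Real.exp_add] at h
  refine h.trans (Real.exp_le_exp.2 ?_)
  have h1 : -(4 / 3) ≤ Real.log (1 - 11 / 15) := by
    rw [Real.le_log_iff_exp_le (by norm_num), Real.exp_neg]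
    rw [show (1 - 11 / 15 : ℝ) = (15 / 4)⁻¹ by norm_num]
    gcongr
    have h4 : Real.exp (4 / 3) = Real.exp (1 / 3) ^ 4 := by rw [← Real.exp_nat_mul]; norm_num
    rw [h4]
    have : (1.395 : ℝ) ≤ Real.exp (1 / 3) := by
      have h5 := Real.sum_le_exp_of_nonneg (x := 1 / 3) (by norm_num) 5
      norm_num [Finset.sum_range_succ, Nat.factorial] at h5
      linarith
    calc (15 / 4 : ℝ) ≤ 1.395 ^ 4 := by norm_num
      _ ≤ _ := by gcongr
  have hc : (0 : ℝ) ≤ Fintype.card ι := Nat.cast_nonneg _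
  have e2 : 11 / 30 / v * m ^ 2 = 11 / 30 * m ^ 2 / v := by ring
  rw [e2]
  nlinarith

end SubgaussianVector

/-! ### Round-robin averages -/

section Average

variable {d : ℕ}

/-- The coordinatewise averages of the observations of the rounds `a ≤ t < a + d k`, where round
`a + d l + j` contributes to coordinate `j`. -/
noncomputable def avg (d a k : ℕ) (y : ℕ → ℝ) : Fin d → ℝ :=
  fun j => (∑ l ∈ Finset.range k, y (a + d * l + j)) / k

lemma avg_congr {a k : ℕ} {y y' : ℕ → ℝ} (h : ∀ t, a ≤ t → t < a + d * k → y t = y' t) :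
    avg d a k y = avg d a k y' := by
  funext j
  simp only [avg]
  congr 1
  refine Finset.sum_congr rfl fun l hl => h _ (by omega) ?_
  have h1 : d * (l + 1) ≤ d * k := Nat.mul_le_mul_left _ (Finset.mem_range.1 hl)
  have := j.2
  rw [mul_add] at h1
  omega

lemma avg_add (a k : ℕ) (y y' : ℕ → ℝ) : avg d a k (y + y') = avg d a k y + avg d a k y' := by
  funext j
  simp [avg, Finset.sum_add_distrib, add_div]

lemma avg_periodic {a k : ℕ} (ha : d ∣ a) (hk : k ≠ 0) (w : Fin d → ℝ) [NeZero d] :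
    avg d a k (fun t => w (Fin.ofNat d t)) = w := by
  funext j
  obtain ⟨b, rfl⟩ := ha
  have h : ∀ l, Fin.ofNat d (d * b + d * l + j) = j := by
    intro l
    ext
    rw [← mul_add]
    simp [Fin.ofNat, Nat.mod_eq_of_lt j.2]
  simp only [avg, h]
  simp [hk]

@[fun_prop]
lemma measurable_avg (a k : ℕ) : Measurable (avg d a k) := by
  unfold avg
  fun_prop

@[fun_prop]
lemma measurable_pairDiff : Measurable pairDiff := by
  unfold pairDiff
  fun_prop

@[fun_prop]
lemma measurable_past (t : ℕ) : Measurable (past t) := by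
  unfold past
  refine measurable_pi_lambda _ fun s => ?_
  by_cases h : s < t <;> simp only [h, if_true, if_false] <;> fun_prop

variable {Ω : Type*} [MeasurableSpace Ω] {μ : Measure Ω} {z : ℕ → Ω → ℝ}

/-- The average for each coordinate uses `k` differences of two noises, and no noise variable serves
twice: this is the injectivity of `g`, which maps (cycle, coordinate, second or first round of the
pair) to a round. Independence then adds the variance proxies. -/
lemma subgaussianVec_avg {c : ℝ≥0} (hz_indep : iIndepFun z μ)
    (hz_subG : ∀ t, HasSubgaussianMGF (z t) c μ) (a : ℕ) {k : ℕ} (hk : k ≠ 0) :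
    SubgaussianVec μ (2 * c / k) fun ω => avg d a k (pairDiff fun t => z t ω) := by
  intro u
  let g : ℕ × Fin d × Bool → ℕ := fun p => 2 * (a + d * p.1 + p.2.1) + if p.2.2 then 1 else 0
  have hg : Function.Injective g := by
    rintro ⟨l, j, b⟩ ⟨l', j', b'⟩ h
    simp only [g] at h
    have h1 : b = b' := by
      cases b <;> cases b' <;> simp at h ⊢ <;> omega
    subst h1
    have h2 : d * l + j = d * l' + j' := by omega
    have h3 : (j : ℕ) = j' := by
      have := congrArg (· % d) h2
      simpa [Nat.mod_eq_of_lt j.2, Nat.mod_eq_of_lt j'.2] using this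
    have h4 : l = l' := by
      have hd : 0 < d := j.pos
      rw [h3] at h2
      exact Nat.eq_of_mul_eq_mul_left hd (by omega)
    simp [h4, Fin.ext_iff, h3]
  let r : ℕ × Fin d × Bool → ℝ := fun p => (u p.2.1 / k) * if p.2.2 then 1 else -1
  have hind : iIndepFun (fun p ω => r p * z (g p) ω) μ :=
    (hz_indep.precomp hg).comp (fun p x => r p * x) fun p => by fun_prop
  have hscale : ∀ p, HasSubgaussianMGF (fun ω => r p * z (g p) ω) (Real.toNNReal (r p ^ 2) * c)
      μ := by
    intro p
    have := (hz_subG (g p)).const_mul (r p)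
    rwa [show (Real.toNNReal (r p ^ 2) : ℝ≥0) = ⟨r p ^ 2, sq_nonneg _⟩ from
      Real.toNNReal_of_nonneg (sq_nonneg _)]
  have hsub := HasSubgaussianMGF.sum_of_iIndepFun hind
    (s := Finset.range k ×ˢ Finset.univ) fun p _ => hscale p
  have e : ∀ ω, ∑ j, u j * avg d a k (pairDiff fun t => z t ω) j =
      ∑ p ∈ Finset.range k ×ˢ Finset.univ, r p * z (g p) ω := by
    intro ω
    rw [Finset.sum_product, Finset.sum_congr rfl fun l _ => Fintype.sum_prod_type _,
      Finset.sum_comm]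
    refine Finset.sum_congr rfl fun j _ => ?_
    simp only [avg, pairDiff, r, g]
    rw [Finset.sum_div, Finset.mul_sum]
    refine Finset.sum_congr rfl fun l _ => ?_
    simp
    ring
  have h1 := hsub.mgf_le 1
  have h2 := hsub.integrable_exp_mul 1
  simp only [one_mul, mgf] at h1 h2
  simp_rw [e]
  rw [← ofReal_integral_eq_lintegral_ofReal h2
    (Filter.Eventually.of_forall fun ω => (Real.exp_pos _).le)]
  refine ENNReal.ofReal_le_ofReal (h1.trans (le_of_eq ?_))
  congr 1
  have hr2 : ∀ p, r p ^ 2 = (u p.2.1 / k) ^ 2 := by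
    intro p
    simp only [r]
    split_ifs <;> ring
  simp only [NNReal.coe_sum, NNReal.coe_mul, Real.coe_toNNReal _ (sq_nonneg _), hr2]
  rw [Finset.sum_product]
  simp only [Fintype.sum_prod_type, Fintype.sum_bool]
  rw [Finset.sum_const, Finset.card_range, nsmul_eq_mul]
  have hk' : (k : ℝ) ≠ 0 := by exact_mod_cast hk
  rw [Finset.mul_sum, Finset.mul_sum, Finset.sum_mul, Finset.sum_div, Finset.sum_div]
  refine Finset.sum_congr rfl fun j _ => ?_
  field_simp
  ring

lemma indepFun_past_avg (hz_meas : ∀ t, Measurable (z t)) (hz_indep : iIndepFun z μ) (a k : ℕ) :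
    IndepFun (fun ω => past a (pairDiff fun t => z t ω))
      (fun ω => avg d a k (pairDiff fun t => z t ω)) μ := by
  let S := Finset.range (2 * a)
  let T := Finset.Ico (2 * a) (2 * (a + d * k))
  -- Extension by `0` outside `U`. It exhibits the two random vectors as functions of disjoint
  -- finite families of noises: rounds below `2a`, and rounds from `2a` on.
  let ext : (U : Finset ℕ) → (U → ℝ) → ℕ → ℝ := fun U x t => if h : t ∈ U then x ⟨t, h⟩ else 0
  have hext : ∀ U, Measurable (ext U) := by
    intro U
    refine measurable_pi_lambda _ fun t => ?_
    by_cases h : t ∈ U <;> simp only [ext, h, dif_pos, dif_neg, not_false_iff] <;> fun_prop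
  have hST : Disjoint S T := by
    rw [Finset.disjoint_left]
    intro t h1 h2
    simp only [S, T, Finset.mem_range, Finset.mem_Ico] at h1 h2
    omega
  have h := hz_indep.indepFun_finset S T hST hz_meas
  have h' := h.comp (φ := fun x => past a (pairDiff (ext S x)))
    (ψ := fun x => avg d a k (pairDiff (ext T x)))
    ((measurable_past a).comp (measurable_pairDiff.comp (hext S)))
    ((measurable_avg a k).comp (measurable_pairDiff.comp (hext T)))
  convert h' using 1
  · funext ω s
    simp only [Function.comp, past, pairDiff, ext, S, Finset.mem_range]
    by_cases hs : s < a
    · simp [hs, show 2 * s + 1 < 2 * a by omega]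
    · simp [hs]
  · funext ω
    refine avg_congr fun t h1 h2 => ?_
    simp only [pairDiff, ext, T, Finset.mem_Ico]
    rw [dif_pos (by omega), dif_pos (by omega)]

end Average

/-! ### Linear algebra of the ellipsoid -/

section LinearAlgebra

variable {d : ℕ} {A : Matrix (Fin d) (Fin d) ℝ}

lemma sqrt_mul_sqrt (hA : A.PosDef) : CFC.sqrt A * CFC.sqrt A = A :=
  CFC.sqrt_mul_sqrt_self A hA.posSemidef.nonneg

lemma sqrt_transpose (A : Matrix (Fin d) (Fin d) ℝ) : (CFC.sqrt A)ᵀ = CFC.sqrt A := by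
  have h : (CFC.sqrt A)ᴴ = CFC.sqrt A := (CFC.sqrt_nonneg A).isSelfAdjoint
  rwa [conjTranspose_eq_transpose_of_trivial] at h

lemma isUnit_sqrt (hA : A.PosDef) : IsUnit (CFC.sqrt A).det := by
  have h := congrArg det (sqrt_mul_sqrt hA)
  rw [det_mul] at h
  have := hA.det_pos
  rw [isUnit_iff_ne_zero]
  rintro h0
  rw [h0] at h
  simp at h
  linarith

lemma sqrt_mulVec_dotProduct (A : Matrix (Fin d) (Fin d) ℝ) (u v : Fin d → ℝ) :
    (CFC.sqrt A *ᵥ u) ⬝ᵥ v = u ⬝ᵥ (CFC.sqrt A *ᵥ v) := by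
  conv_lhs => rw [← sqrt_transpose A]
  rw [mulVec_transpose, ← dotProduct_mulVec]

/-- With `matNorm_inv_sqrt_mulVec`, this reduces the ellipsoid to the Euclidean unit ball. -/
lemma matNorm_eq (hA : A.PosDef) (u : Fin d → ℝ) :
    matNorm A u = √(∑ j, (CFC.sqrt A *ᵥ u) j ^ 2) := by
  rw [matNorm]
  congr 1
  conv_lhs => rw [← sqrt_mul_sqrt hA]
  rw [← mulVec_mulVec, ← sqrt_mulVec_dotProduct]
  simp [dotProduct, sq]

lemma matNorm_inv_sqrt_mulVec (hA : A.PosDef) (u : Fin d → ℝ) :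
    matNorm A⁻¹ (CFC.sqrt A *ᵥ u) = √(∑ j, u j ^ 2) := by
  rw [matNorm]
  congr 1
  have hR := isUnit_sqrt hA
  have : A⁻¹ *ᵥ (CFC.sqrt A *ᵥ u) = (CFC.sqrt A)⁻¹ *ᵥ u := by
    have h : A⁻¹ = (CFC.sqrt A)⁻¹ * (CFC.sqrt A)⁻¹ := by
      rw [← Matrix.mul_inv_rev, sqrt_mul_sqrt hA]
    rw [h, mulVec_mulVec, mul_assoc, nonsing_inv_mul _ hR, mul_one]
  rw [this, sqrt_mulVec_dotProduct, mulVec_mulVec, mul_nonsing_inv _ hR, one_mulVec]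
  simp [dotProduct, sq]

lemma mem_ellipsoid_zero_iff (hA : A.PosDef) (u : Fin d → ℝ) :
    CFC.sqrt A *ᵥ u ∈ ellipsoid 0 A ↔ ∑ j, u j ^ 2 ≤ 1 := by
  simp only [ellipsoid, Set.mem_ofPred_eq, sub_zero]
  rw [matNorm_inv_sqrt_mulVec hA, Real.sqrt_le_one]

lemma exists_sqrt_mulVec (hA : A.PosDef) (x : Fin d → ℝ) : ∃ u, CFC.sqrt A *ᵥ u = x :=
  ⟨(CFC.sqrt A)⁻¹ *ᵥ x, by rw [mulVec_mulVec, mul_nonsing_inv _ (isUnit_sqrt hA), one_mulVec]⟩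

lemma sq_dotProduct_le (u v : Fin d → ℝ) : (u ⬝ᵥ v) ^ 2 ≤ (∑ j, u j ^ 2) * ∑ j, v j ^ 2 :=
  Finset.sum_mul_sq_le_sq_mul_sq _ _ _

/-- The linear functional `v` is at most `‖v‖_A` on the ellipsoid, in absolute value. -/
lemma abs_dotProduct_le (hA : A.PosDef) {x : Fin d → ℝ} (hx : x ∈ ellipsoid 0 A)
    (v : Fin d → ℝ) : |x ⬝ᵥ v| ≤ matNorm A v := by
  obtain ⟨u, rfl⟩ := exists_sqrt_mulVec hA x
  rw [mem_ellipsoid_zero_iff hA] at hx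
  rw [sqrt_mulVec_dotProduct, matNorm_eq hA]
  refine Real.abs_le_sqrt ((sq_dotProduct_le _ _).trans ?_)
  exact mul_le_of_le_one_left (Finset.sum_nonneg fun _ _ => sq_nonneg _) hx

/-- A maximizer over the centered ellipsoid, in the coordinates given by `A^{1/2}`. -/
lemma IsArgmax.eq_of_pos (hA : A.PosDef) {v x : Fin d → ℝ} (hx : IsArgmax (ellipsoid 0 A) v x)
    (hv : 0 < matNorm A v) :
    x = CFC.sqrt A *ᵥ ((matNorm A v)⁻¹ • (CFC.sqrt A *ᵥ v)) := by
  obtain ⟨u, rfl⟩ := exists_sqrt_mulVec hA x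
  obtain ⟨h1, h2⟩ := hx
  set p := CFC.sqrt A *ᵥ v with hp
  set m := matNorm A v with hm
  have hm2 : m ^ 2 = ∑ j, p j ^ 2 := by
    rw [hm, matNorm_eq hA, Real.sq_sqrt (Finset.sum_nonneg fun _ _ => sq_nonneg _)]
  rw [mem_ellipsoid_zero_iff hA] at h1
  have h3 : ∑ j, (m⁻¹ • p) j ^ 2 = 1 := by
    simp only [Pi.smul_apply, smul_eq_mul, mul_pow]
    rw [← Finset.mul_sum, ← hm2]
    field_simp
  have h4 := h2 _ ((mem_ellipsoid_zero_iff hA _).2 h3.le)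
  rw [sqrt_mulVec_dotProduct, sqrt_mulVec_dotProduct, ← hp, smul_dotProduct, smul_eq_mul] at h4
  have h5 : p ⬝ᵥ p = m ^ 2 := by rw [hm2]; simp [dotProduct, sq]
  rw [h5] at h4
  -- Equality case of Cauchy-Schwarz: `|u| ≤ 1`, `|m⁻¹ p| = 1` and `u · p ≥ m` by maximality, so the
  -- squared distance is at most `1 + 1 - 2`.
  have h6 : ∑ j, (u j - (m⁻¹ • p) j) ^ 2 ≤ 0 := by
    have e : ∑ j, (u j - (m⁻¹ • p) j) ^ 2 =
        ∑ j, u j ^ 2 + ∑ j, (m⁻¹ • p) j ^ 2 - 2 * m⁻¹ * (u ⬝ᵥ p) := by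
      rw [dotProduct, Finset.mul_sum, ← Finset.sum_add_distrib, ← Finset.sum_sub_distrib]
      refine Finset.sum_congr rfl fun j _ => ?_
      simp only [Pi.smul_apply, smul_eq_mul]
      ring
    rw [e, h3]
    have : m⁻¹ * m ^ 2 ≤ u ⬝ᵥ p := h4
    have h7 : m⁻¹ * (m⁻¹ * m ^ 2) ≤ m⁻¹ * (u ⬝ᵥ p) := by gcongr
    have h8 : m⁻¹ * (m⁻¹ * m ^ 2) = 1 := by field_simp
    linarith
  congr 1
  funext j
  have h7 := (Finset.sum_eq_zero_iff_of_nonneg (fun j _ => sq_nonneg (u j - (m⁻¹ • p) j))).1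
    (le_antisymm h6 (Finset.sum_nonneg fun _ _ => sq_nonneg _)) j (Finset.mem_univ _)
  have := pow_eq_zero_iff (two_ne_zero) |>.1 h7
  linarith

/-- The value of the optimal action over the translated ellipsoid. -/
lemma IsArgmax.dotProduct_eq (hA : A.PosDef) {c θ x : Fin d → ℝ}
    (hx : IsArgmax (ellipsoid c A) θ x) : x ⬝ᵥ θ = c ⬝ᵥ θ + matNorm A θ := by
  have h0 : x - c ∈ ellipsoid 0 A := by simpa [ellipsoid] using hx.1
  have h1 := (abs_le.1 (abs_dotProduct_le hA h0 θ)).2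
  rw [sub_dotProduct] at h1
  refine le_antisymm (by linarith) ?_
  set p := CFC.sqrt A *ᵥ θ with hp
  set m := matNorm A θ with hm
  have hm2 : m ^ 2 = ∑ j, p j ^ 2 := by
    rw [hm, matNorm_eq hA, Real.sq_sqrt (Finset.sum_nonneg fun _ _ => sq_nonneg _)]
  -- For `m = 0` the convention `m⁻¹ = 0` turns the competitor into the centre `c`, which is optimal
  -- in that case.
  have h3 : ∑ j, (m⁻¹ • p) j ^ 2 ≤ 1 := by
    simp only [Pi.smul_apply, smul_eq_mul, mul_pow]
    rw [← Finset.mul_sum, ← hm2]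
    by_cases h : m = 0
    · simp [h]
    · field_simp; rfl
  have h4 := hx.2 (c + CFC.sqrt A *ᵥ (m⁻¹ • p)) (by
    have := (mem_ellipsoid_zero_iff hA _).2 h3
    simpa [ellipsoid] using this)
  rw [add_dotProduct, sqrt_mulVec_dotProduct, ← hp, smul_dotProduct, smul_eq_mul] at h4
  have h5 : p ⬝ᵥ p = m ^ 2 := by rw [hm2]; simp [dotProduct, sq]
  rw [h5] at h4
  have h6 : m⁻¹ * m ^ 2 = m := by
    by_cases h : m = 0
    · simp [h]
    · field_simp
  linarith

variable [NeZero d]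

lemma roundRobin_mem (hA : A.PosDef) (t : ℕ) : roundRobin A t ∈ ellipsoid 0 A := by
  rw [roundRobin, mem_ellipsoid_zero_iff hA]
  simp [Pi.single_apply]

lemma roundRobin_dotProduct (A : Matrix (Fin d) (Fin d) ℝ) (t : ℕ) (θ : Fin d → ℝ) :
    roundRobin A t ⬝ᵥ θ = (CFC.sqrt A *ᵥ θ) (Fin.ofNat d t) := by
  rw [roundRobin, sqrt_mulVec_dotProduct, single_dotProduct, one_mul]

lemma sum_Ico_roundRobin {M : Type*} [AddCommMonoid M] {a : ℕ} (ha : d ∣ a) (k : ℕ)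
    (f : Fin d → ℕ → M) :
    ∑ t ∈ Finset.Ico a (a + d * k), f (Fin.ofNat d t) t =
      ∑ j : Fin d, ∑ l ∈ Finset.range k, f j (a + d * l + j) := by
  obtain ⟨b, rfl⟩ := ha
  induction k with
  | zero => simp
  | succ k ih =>
    rw [mul_add, ← add_assoc, mul_one, ← Finset.sum_Ico_consecutive _ (Nat.le_add_right _ (d * k))
      (Nat.le_add_right _ d), ih]
    simp_rw [Finset.sum_range_succ]
    rw [Finset.sum_add_distrib]
    congr 1
    rw [Finset.sum_Ico_eq_sum_range, Nat.add_sub_cancel_left, Finset.sum_range]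
    refine Finset.sum_congr rfl fun j _ => ?_
    congr 1
    ext
    rw [← mul_add]
    simp [Fin.ofNat, Nat.mod_eq_of_lt j.2]

/-- The least-squares estimate from round-robin observations is the vector of the coordinatewise
averages, in the coordinates given by `A^{1/2}`. -/
lemma sqrt_mulVec_estimate (hA : A.PosDef) {a k : ℕ} (ha : d ∣ a) (hk : k ≠ 0) (y : ℕ → ℝ) :
    CFC.sqrt A *ᵥ estimate A a (a + d * k) y = avg d a k y := by
  set R := CFC.sqrt A with hR
  set X : Matrix (Finset.Ico a (a + d * k)) (Fin d) ℝ :=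
    Matrix.of fun t => roundRobin A t with hX
  have hk' : (k : ℝ) ≠ 0 := by exact_mod_cast hk
  have hcol : ∀ t : ℕ, ∀ j, roundRobin A t j = R j (Fin.ofNat d t) := by
    intro t j
    rw [roundRobin, mulVec_single_one]
    rfl
  -- Each cycle plays all the columns of `R` once and contributes `R Rᵀ = A`.
  have h1 : Xᵀ * X = (k : ℝ) • A := by
    ext i j
    rw [Matrix.mul_apply, Matrix.smul_apply, smul_eq_mul]
    simp only [transpose_apply, hX, of_apply, hcol]
    rw [Finset.sum_coe_sort (Finset.Ico a (a + d * k))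
      (fun t => R i (Fin.ofNat d t) * R j (Fin.ofNat d t)),
      sum_Ico_roundRobin ha k fun q _ => R i q * R j q]
    simp only [Finset.sum_const, Finset.card_range, nsmul_eq_mul]
    rw [← Finset.mul_sum]
    congr 1
    have := congrFun (congrFun (sqrt_mul_sqrt hA) i) j
    rw [← this, Matrix.mul_apply]
    refine Finset.sum_congr rfl fun q _ => ?_
    congr 1
    have := congrFun (congrFun (sqrt_transpose A) j) q
    exact this.symm
  have h2 : Xᵀ *ᵥ (fun t : Finset.Ico a (a + d * k) => y t) = R *ᵥ ((k : ℝ) • avg d a k y) := by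
    funext i
    simp only [mulVec, dotProduct, transpose_apply, hX, of_apply, hcol]
    rw [Finset.sum_coe_sort (Finset.Ico a (a + d * k)) (fun t => R i (Fin.ofNat d t) * y t),
      sum_Ico_roundRobin ha k fun q t => R i q * y t]
    refine Finset.sum_congr rfl fun q _ => ?_
    rw [← Finset.mul_sum]
    congr 1
    simp only [Pi.smul_apply, smul_eq_mul, avg]
    field_simp
  have hRu : IsUnit R.det := isUnit_sqrt hA
  rw [estimate, leastSquares, h1, h2]
  have h3 : ((k : ℝ) • A)⁻¹ = (k : ℝ)⁻¹ • (R⁻¹ * R⁻¹) := by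
    refine Matrix.inv_eq_right_inv ?_
    rw [smul_mul_smul_comm, mul_inv_cancel₀ hk', one_smul, ← sqrt_mul_sqrt hA, ← hR, mul_assoc,
      ← mul_assoc R R⁻¹, mul_nonsing_inv _ hRu, one_mul, mul_nonsing_inv _ hRu]
  simp only [h3, mulVec_smul, mulVec_mulVec, Matrix.smul_mul, smul_mulVec, smul_smul]
  rw [mul_inv_cancel₀ hk', one_smul, mul_assoc R⁻¹, nonsing_inv_mul _ hRu, mul_one,
    mul_nonsing_inv _ hRu, one_mulVec]

lemma matNorm_estimate (hA : A.PosDef) {a k : ℕ} (ha : d ∣ a) (hk : k ≠ 0) (y : ℕ → ℝ) :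
    matNorm A (estimate A a (a + d * k) y) = √(∑ j, avg d a k y j ^ 2) := by
  rw [matNorm_eq hA, sqrt_mulVec_estimate hA ha hk]

end LinearAlgebra

/-! ### The reduction, in terms of the observations of the centered algorithm -/

section Reduction

variable {d : ℕ}

lemma past_congr {t : ℕ} {y y' : ℕ → ℝ} (h : ∀ s < t, y s = y' s) : past t y = past t y' := by
  funext s
  simp only [past]
  split_ifs with hs
  · exact h s hs
  · rfl

lemma past_apply {t s : ℕ} (y : ℕ → ℝ) (h : s < t) : past t y s = y s := by simp [past, h]

lemma reward_eq (π : Policy d) (θ : Fin d → ℝ) (z : ℕ → ℝ) (t : ℕ) :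
    reward π θ z t = action π θ z t ⬝ᵥ θ + z t := by
  rw [reward, action]
  rfl

lemma past_pairDiff_past {j t : ℕ} (h : j ≤ t / 2) (y : ℕ → ℝ) :
    past j (pairDiff (past t y)) = past j (pairDiff y) := by
  refine past_congr fun s hs => ?_
  simp only [pairDiff]
  rw [past_apply _ (by omega), past_apply _ (by omega)]

/-! ### The translated policy, compared with perpetual exploration -/

section Translated

variable {𝒜 : ETCAlgorithm d} {c θ : Fin d → ℝ} {z : ℕ → ℝ} {Y : ℕ → ℝ}

lemma action_translated_of_not_done {t : ℕ}
    (h : ∀ j ≤ t / 2, ¬ 𝒜.done j (past j (pairDiff (reward (translated 𝒜 c) θ z)))) :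
    action (translated 𝒜 c) θ z t = if t % 2 = 0 then c else
      c + 𝒜.explore (t / 2) (past (t / 2) (pairDiff (reward (translated 𝒜 c) θ z))) := by
  rw [action]
  conv_lhs => rw [translated]
  rw [dif_neg, past_pairDiff_past le_rfl]
  rintro ⟨j, hj, hd⟩
  rw [past_pairDiff_past hj] at hd
  exact h j hj hd

lemma action_translated_of_done {t j : ℕ} (hj : j ≤ t / 2)
    (hd : 𝒜.done j (past j (pairDiff (reward (translated 𝒜 c) θ z))))
    (hmin : ∀ i < j, ¬ 𝒜.done i (past i (pairDiff (reward (translated 𝒜 c) θ z)))) :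
    action (translated 𝒜 c) θ z t =
      c + 𝒜.commit j (past j (pairDiff (reward (translated 𝒜 c) θ z))) := by
  classical
  rw [action]
  conv_lhs => rw [translated]
  have hex : ∃ i, i ≤ t / 2 ∧
      𝒜.done i (past i (pairDiff (past t (reward (translated 𝒜 c) θ z)))) :=
    ⟨j, hj, by rwa [past_pairDiff_past hj]⟩
  have hfind : Nat.find hex = j := by
    rw [Nat.find_eq_iff]
    refine ⟨⟨hj, by rwa [past_pairDiff_past hj]⟩, ?_⟩
    rintro i hi ⟨h1, h2⟩
    rw [past_pairDiff_past h1] at h2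
    exact hmin i hi h2
  rw [dif_pos hex]
  have : ∀ i, i = j → c + 𝒜.commit i (past i (pairDiff (past t (reward (translated 𝒜 c) θ z)))) =
      c + 𝒜.commit j (past j (pairDiff (reward (translated 𝒜 c) θ z))) := by
    rintro i rfl
    rw [past_pairDiff_past hj]
  convert this _ hfind

/-- As long as the centered algorithm explores on the observations `Y` it would see if it
explored for ever, these are the observations it is given. -/
lemma pairDiff_reward_eq
    (hY : ∀ s, Y s = 𝒜.explore s (past s Y) ⬝ᵥ θ + pairDiff z s) {n : ℕ}
    (h : ∀ j ≤ n, ¬ 𝒜.done j (past j Y)) :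
    ∀ s ≤ n, pairDiff (reward (translated 𝒜 c) θ z) s = Y s := by
  intro s
  induction s using Nat.strong_induction_on with
  | _ s ih =>
    intro hs
    have hpast : ∀ j ≤ s, past j (pairDiff (reward (translated 𝒜 c) θ z)) = past j Y :=
      fun j hj => past_congr fun i hi => ih i (by omega) (by omega)
    have hnd : ∀ j ≤ s, ¬ 𝒜.done j (past j (pairDiff (reward (translated 𝒜 c) θ z))) := by
      intro j hj
      rw [hpast j hj]
      exact h j (by omega)
    have e1 : (2 * s + 1) / 2 = s := by omega
    have e2 : (2 * s) / 2 = s := by omega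
    rw [pairDiff, reward_eq, reward_eq, action_translated_of_not_done (by rwa [e1]),
      action_translated_of_not_done (by rwa [e2]), e1, if_neg (by omega), if_pos (by omega),
      hpast s le_rfl, hY s, pairDiff, add_dotProduct]
    ring

/-- With `j < n` strict in the hypothesis, the agreement covers the data available when exploration
is first over, which are the data that the commit rule reads. -/
lemma past_pairDiff_reward_eq
    (hY : ∀ s, Y s = 𝒜.explore s (past s Y) ⬝ᵥ θ + pairDiff z s) {n : ℕ}
    (h : ∀ j < n, ¬ 𝒜.done j (past j Y)) {j : ℕ} (hj : j ≤ n) :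
    past j (pairDiff (reward (translated 𝒜 c) θ z)) = past j Y := by
  rcases Nat.eq_zero_or_pos n with rfl | hn
  · obtain rfl : j = 0 := by omega
    exact past_congr fun s hs => absurd hs (by omega)
  · exact past_congr fun s hs =>
      pairDiff_reward_eq (n := n - 1) hY (fun i hi => h i (by omega)) s (by omega)

lemma action_translated_explore
    (hY : ∀ s, Y s = 𝒜.explore s (past s Y) ⬝ᵥ θ + pairDiff z s) {t : ℕ}
    (h : ∀ j ≤ t / 2, ¬ 𝒜.done j (past j Y)) :
    action (translated 𝒜 c) θ z t =
      if t % 2 = 0 then c else c + 𝒜.explore (t / 2) (past (t / 2) Y) := by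
  have hp : ∀ j ≤ t / 2, past j (pairDiff (reward (translated 𝒜 c) θ z)) = past j Y := fun j hj =>
    past_pairDiff_reward_eq hY (n := t / 2) (fun i hi => h i hi.le) hj
  rw [action_translated_of_not_done fun j hj => by rw [hp j hj]; exact h j hj, hp _ le_rfl]

lemma action_translated_commit
    (hY : ∀ s, Y s = 𝒜.explore s (past s Y) ⬝ᵥ θ + pairDiff z s) {t j : ℕ} (hj : j ≤ t / 2)
    (hd : 𝒜.done j (past j Y)) (hmin : ∀ i < j, ¬ 𝒜.done i (past i Y)) :
    action (translated 𝒜 c) θ z t = c + 𝒜.commit j (past j Y) := by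
  have hp : ∀ i ≤ j, past i (pairDiff (reward (translated 𝒜 c) θ z)) = past i Y := fun i hi =>
    past_pairDiff_reward_eq hY (n := j) hmin hi
  rw [action_translated_of_done hj (by rwa [hp j le_rfl])
    (fun i hi => by rw [hp i hi.le]; exact hmin i hi), hp j le_rfl]

end Translated

/-! ### Stopping times and estimates of E2TC on truncated data -/

section E2TC

variable [NeZero d] {A : Matrix (Fin d) (Fin d) ℝ} {α s H : ℝ}

lemma estimate_congr {a b : ℕ} {y y' : ℕ → ℝ} (h : ∀ t, a ≤ t → t < b → y t = y' t) :
    estimate A a b y = estimate A a b y' := by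
  rw [estimate, estimate]
  congr 1
  funext t
  have := Finset.mem_Ico.1 t.2
  exact h t this.1 this.2

lemma blockEnd_mono (d : ℕ) : Monotone (blockEnd d) := by
  intro i j h
  have : 2 ^ i ≤ 2 ^ j := Nat.pow_le_pow_right (by norm_num) h
  exact Nat.mul_le_mul_left _ (by omega)

lemma blockNorm_past {y : ℕ → ℝ} {i j : ℕ} (h : blockEnd d i ≤ j) :
    blockNorm A (past j y) i = blockNorm A y i := by
  rw [blockNorm, blockNorm, estimate_congr fun t _ ht => past_apply _ (by omega)]

lemma exploreEnd_past {y : ℕ → ℝ} {i j : ℕ} (h : blockEnd d i ≤ j) :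
    exploreEnd A s H (past j y) i = exploreEnd A s H y i := by
  rw [exploreEnd, exploreEnd, blockNorm_past h]

lemma warmupEnds_congr {y y' : ℕ → ℝ} {i : ℕ} (h : ∀ j ≤ i, blockNorm A y j = blockNorm A y' j) :
    WarmupEnds A α s H y i ↔ WarmupEnds A α s H y' i := by
  have key : ∀ {y y' : ℕ → ℝ}, (∀ j ≤ i, blockNorm A y j = blockNorm A y' j) →
      WarmupEnds A α s H y i → WarmupEnds A α s H y' i := by
    rintro y y' h ⟨⟨h1, h2⟩, h3⟩
    refine ⟨⟨h1, by rwa [← h i le_rfl]⟩, fun j hj => ?_⟩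
    by_contra hlt
    push Not at hlt
    have := h3 (show j ∈ _ from ⟨hj.1, by rw [h j hlt.le]; exact hj.2⟩)
    omega
  exact ⟨key h, key fun j hj => (h j hj).symm⟩

lemma warmupEnds_past {y : ℕ → ℝ} {i j : ℕ} (h : blockEnd d i ≤ j) :
    WarmupEnds A α s H (past j y) i ↔ WarmupEnds A α s H y i :=
  warmupEnds_congr fun _ hk => blockNorm_past ((blockEnd_mono d hk).trans h)

lemma WarmupEnds.unique {y : ℕ → ℝ} {i j : ℕ} (hi : WarmupEnds A α s H y i)
    (hj : WarmupEnds A α s H y j) : i = j :=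
  IsLeast.unique hi hj

lemma blockEnd_le_exploreEnd (y : ℕ → ℝ) (i : ℕ) : blockEnd d i ≤ exploreEnd A s H y i :=
  Nat.le_add_right _ _

/-- Truncation puts zeros in place of later observations and could distort the stopping test. But
`exploreEnd ≤ j` forces `blockEnd d i ≤ j`, and blocks up to the `i`-th are then untouched. -/
lemma e2tc_done_past {xs : (Fin d → ℝ) → (Fin d → ℝ)} {y : ℕ → ℝ} {j : ℕ} :
    (e2tc A xs α s H).done j (past j y) ↔
      ∃ i, WarmupEnds A α s H y i ∧ exploreEnd A s H y i ≤ j := by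
  constructor
  · rintro ⟨i, h1, h2⟩
    have h3 := (blockEnd_le_exploreEnd (A := A) (s := s) (H := H) (past j y) i).trans h2
    exact ⟨i, (warmupEnds_past h3).1 h1, by rwa [exploreEnd_past h3] at h2⟩
  · rintro ⟨i, h1, h2⟩
    have h3 := (blockEnd_le_exploreEnd (A := A) (s := s) (H := H) y i).trans h2
    exact ⟨i, (warmupEnds_past h3).2 h1, by rwa [exploreEnd_past h3]⟩

lemma e2tc_commit_past {xs : (Fin d → ℝ) → (Fin d → ℝ)} {y : ℕ → ℝ} {i j : ℕ}
    (h : WarmupEnds A α s H y i) (hj : exploreEnd A s H y i ≤ j) :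
    (e2tc A xs α s H).commit j (past j y) =
      xs (estimate A (blockEnd d i) (exploreEnd A s H y i) y) := by
  have h3 := (blockEnd_le_exploreEnd (A := A) (s := s) (H := H) y i).trans hj
  have hex : ∃ i, WarmupEnds A α s H (past j y) i := ⟨i, (warmupEnds_past h3).2 h⟩
  have hc : hex.choose = i := hex.choose_spec.unique ((warmupEnds_past h3).2 h)
  simp only [e2tc]
  rw [dif_pos hex, hc, exploreEnd_past h3]
  congr 1
  exact estimate_congr fun t _ ht => past_apply _ (by omega)

/-- The observations of the centered algorithm if it explored for ever. -/
noncomputable def exploreObs (A : Matrix (Fin d) (Fin d) ℝ) (θ : Fin d → ℝ) (ζ : ℕ → ℝ) : ℕ → ℝ :=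
  fun t => (CFC.sqrt A *ᵥ θ) (Fin.ofNat d t) + ζ t

variable {c θ : Fin d → ℝ} {σ T : ℝ} {xs : (Fin d → ℝ) → (Fin d → ℝ)} {z : ℕ → ℝ}

lemma exploreObs_eq (t : ℕ) : exploreObs A θ (pairDiff z) t =
    (e2tc A xs α s H).explore t (past t (exploreObs A θ (pairDiff z))) ⬝ᵥ θ + pairDiff z t := by
  simp only [e2tc, exploreObs, roundRobin_dotProduct]

lemma action_explore {t : ℕ}
    (h : ∀ i, WarmupEnds A α (√2 * σ) (T / 2) (exploreObs A θ (pairDiff z)) i →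
      t / 2 < exploreEnd A (√2 * σ) (T / 2) (exploreObs A θ (pairDiff z)) i) :
    action (translatedE2TC c A xs α σ T) θ z t =
      if t % 2 = 0 then c else c + roundRobin A (t / 2) := by
  rw [translatedE2TC, action_translated_explore (Y := exploreObs A θ (pairDiff z)) exploreObs_eq]
  · rfl
  · intro j hj hd
    obtain ⟨i, h1, h2⟩ := e2tc_done_past.1 hd
    have := h i h1
    omega

lemma action_commit {t i : ℕ}
    (hi : WarmupEnds A α (√2 * σ) (T / 2) (exploreObs A θ (pairDiff z)) i)
    (ht : exploreEnd A (√2 * σ) (T / 2) (exploreObs A θ (pairDiff z)) i ≤ t / 2) :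
    action (translatedE2TC c A xs α σ T) θ z t =
      c + xs (estimate A (blockEnd d i)
        (exploreEnd A (√2 * σ) (T / 2) (exploreObs A θ (pairDiff z)) i)
        (exploreObs A θ (pairDiff z))) := by
  rw [translatedE2TC, action_translated_commit (Y := exploreObs A θ (pairDiff z)) exploreObs_eq ht
    (e2tc_done_past.2 ⟨i, hi, le_rfl⟩), e2tc_commit_past hi le_rfl]
  intro j hj hd
  obtain ⟨i', h1, h2⟩ := e2tc_done_past.1 hd
  obtain rfl := h1.unique hi
  omega

end E2TC

end Reduction

/-! ### Sums along doubling sequences -/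

section Doubling

/-- The right-hand side is `3 exp (-y) sinh (y/3)`, so this is `y/3 ≤ sinh (y/3)`. Its form
telescopes when `y` doubles. -/
lemma mul_exp_neg_le {y : ℝ} (hy : 0 ≤ y) :
    y * Real.exp (-y) ≤ 3 / 2 * (Real.exp (-(2 / 3 * y)) - Real.exp (-(2 / 3 * (2 * y)))) := by
  have h := Real.self_le_sinh_iff.2 (show 0 ≤ y / 3 by linarith)
  rw [Real.sinh_eq] at h
  have h1 : Real.exp (-(2 / 3 * y)) = Real.exp (y / 3) * Real.exp (-y) := by
    rw [← Real.exp_add]; ring_nf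
  have h2 : Real.exp (-(2 / 3 * (2 * y))) = Real.exp (-(y / 3)) * Real.exp (-y) := by
    rw [← Real.exp_add]; ring_nf
  rw [h1, h2]
  nlinarith [Real.exp_pos (-y)]

lemma sum_doubling_mul_exp_le {x : ℝ} (hx : 0 ≤ x) (N : ℕ) :
    ∑ i ∈ Finset.range N, x * 2 ^ i * Real.exp (-(x * 2 ^ i)) ≤ 3 / 2 := by
  have h : ∑ i ∈ Finset.range N, x * 2 ^ i * Real.exp (-(x * 2 ^ i)) ≤
      ∑ i ∈ Finset.range N, (3 / 2 * Real.exp (-(2 / 3 * (x * 2 ^ i))) -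
        3 / 2 * Real.exp (-(2 / 3 * (x * 2 ^ (i + 1))))) := by
    refine Finset.sum_le_sum fun i _ => ?_
    have := mul_exp_neg_le (y := x * 2 ^ i) (by positivity)
    rw [pow_succ, show x * (2 ^ i * 2) = 2 * (x * 2 ^ i) by ring]
    linarith
  rw [Finset.sum_range_sub' (fun i => 3 / 2 * Real.exp (-(2 / 3 * (x * 2 ^ i))))] at h
  have h1 : Real.exp (-(2 / 3 * (x * 2 ^ 0))) ≤ 1 := by
    rw [Real.exp_le_one_iff]
    simp only [pow_zero, mul_one]
    linarith
  have h2 := Real.exp_pos (-(2 / 3 * (x * 2 ^ N)))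
  linarith

/-- A geometric sum of ratio `2` is at most twice its largest term. -/
lemma sum_doubling_filter_le {x B : ℝ} (hx : 0 ≤ x) (hB : 0 ≤ B) (N : ℕ) :
    ∑ i ∈ Finset.range N with x * 2 ^ i ≤ B, x * 2 ^ i ≤ 2 * B := by
  by_cases hne : ((Finset.range N).filter fun i => x * 2 ^ i ≤ B).Nonempty
  · set S := (Finset.range N).filter fun i => x * 2 ^ i ≤ B
    have hmem := S.max'_mem hne
    have h1 : x * 2 ^ S.max' hne ≤ B := (Finset.mem_filter.1 hmem).2
    calc ∑ i ∈ S, x * 2 ^ i ≤ ∑ i ∈ Finset.range (S.max' hne + 1), x * 2 ^ i := by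
          refine Finset.sum_le_sum_of_subset_of_nonneg ?_ fun _ _ _ => by positivity
          intro i hi
          exact Finset.mem_range.2 (Nat.lt_succ_of_le (S.le_max' i hi))
      _ = x * (2 ^ (S.max' hne + 1) - 1) := by
          rw [← Finset.mul_sum, geom_sum_eq (by norm_num)]
          norm_num
      _ ≤ 2 * B := by rw [pow_succ]; nlinarith
  · rw [Finset.not_nonempty_iff_eq_empty] at hne
    rw [hne]
    simpa using hB

/-- If `a` and `b` are the extreme indices, then `2 ^ (b - a + 4) q ≤ H`, and `1 / log 2 < 29/20`.
-/
lemma card_doubling_le {x q H : ℝ} (hq : 0 < q) (N : ℕ) :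
    (((Finset.range N).filter fun i => 16 * q ≤ x * 2 ^ i ∧ x * 2 ^ i < H).card : ℝ) ≤
      29 / 20 * Real.log (max (H / q) 1) := by
  set S := (Finset.range N).filter fun i => 16 * q ≤ x * 2 ^ i ∧ x * 2 ^ i < H with hS
  have hlog : 0 ≤ Real.log (max (H / q) 1) := Real.log_nonneg (le_max_right _ _)
  by_cases hne : S.Nonempty
  · set a := S.min' hne
    set b := S.max' hne
    have ha := (Finset.mem_filter.1 (S.min'_mem hne)).2
    have hb := (Finset.mem_filter.1 (S.max'_mem hne)).2
    have hab : a ≤ b := S.min'_le_max' hne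
    have hcard : S.card ≤ b - a + 1 := by
      have : S ⊆ Finset.Icc a b := fun i hi =>
        Finset.mem_Icc.2 ⟨S.min'_le i hi, S.le_max' i hi⟩
      have := Finset.card_le_card this
      rw [Nat.card_Icc] at this
      omega
    have h1 : (2 : ℝ) ^ (b - a + 4) * q ≤ H := by
      have e : x * 2 ^ b = x * 2 ^ a * 2 ^ (b - a) := by
        rw [mul_assoc, ← pow_add, Nat.add_sub_cancel' hab]
      have hb' := hb.2
      change x * 2 ^ b < H at hb'
      rw [e] at hb'
      have ha' : 16 * q ≤ x * 2 ^ a := ha.1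
      have := mul_le_mul_of_nonneg_right ha' (show (0 : ℝ) ≤ 2 ^ (b - a) by positivity)
      rw [pow_add]
      nlinarith
    have h2 : ((b - a + 4 : ℕ) : ℝ) * Real.log 2 ≤ Real.log (max (H / q) 1) := by
      rw [← Real.log_pow]
      refine Real.log_le_log (by positivity) (le_trans ?_ (le_max_left _ _))
      rwa [le_div_iff₀ hq]
    have h3 := Real.log_two_gt_d9
    have h4 : (S.card : ℝ) ≤ ((b - a + 4 : ℕ) : ℝ) := by exact_mod_cast hcard.trans (by omega)
    nlinarith
  · rw [Finset.not_nonempty_iff_eq_empty] at hne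
    rw [hne]
    simp only [Finset.card_empty, Nat.cast_zero]
    positivity

end Doubling

/-! ### The confidence radius -/

section Radius

lemma one_le_radius_factor {d : ℕ} {δ : ℝ} (hδ : 0 < δ) (hδ1 : δ ≤ 1) :
    0 ≤ 2 * √(1 / d * Real.log (1 / δ)) + 2 / d * Real.log (1 / δ) := by
  have : 0 ≤ Real.log (1 / δ) := Real.log_nonneg (by rw [le_div_iff₀ hδ]; linarith)
  positivity

lemma confRadius_sq {d n : ℕ} {s δ : ℝ} (hδ : 0 < δ) (hδ1 : δ ≤ 1) :
    confRadius d s δ n ^ 2 = s ^ 2 * (d : ℝ) ^ 2 / n *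
      (1 + 2 * √(1 / d * Real.log (1 / δ)) + 2 / d * Real.log (1 / δ)) := by
  rw [confRadius, Real.sq_sqrt]
  have := one_le_radius_factor (d := d) hδ hδ1
  have h : 0 ≤ 1 + 2 * √(1 / d * Real.log (1 / δ)) + 2 / d * Real.log (1 / δ) := by linarith
  positivity

lemma confRadius_nonneg {d n : ℕ} {s δ : ℝ} : 0 ≤ confRadius d s δ n := Real.sqrt_nonneg _

lemma le_confRadius_sq {d n : ℕ} {s δ : ℝ} (hδ : 0 < δ) (hδ1 : δ ≤ 1) :
    s ^ 2 * (d : ℝ) ^ 2 / n ≤ confRadius d s δ n ^ 2 := by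
  rw [confRadius_sq hδ hδ1]
  have := one_le_radius_factor (d := d) hδ hδ1
  exact le_mul_of_one_le_right (by positivity) (by linarith)

variable {Ω : Type*} [MeasurableSpace Ω] {d : ℕ} [NeZero d]

/-- The probability that a subgaussian vector exceeds the confidence radius, with a margin. -/
lemma SubgaussianVec.confRadius_tail_le {μ : Measure Ω} [IsProbabilityMeasure μ] {s δ a g : ℝ}
    {k : ℕ} (hs : 0 < s) (hk : k ≠ 0) {X : Ω → Fin d → ℝ}
    (hX : SubgaussianVec μ (s ^ 2 / k) X) (hm : Measurable X) (hδ : 0 < δ) (hδ1 : δ ≤ 1)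
    (ha : 0 ≤ a) (hg : 2 * √a + 2 * a ≤ g) :
    μ.real {ω | confRadius d s δ (d * k) ^ 2 + g * (s ^ 2 * (d : ℝ) ^ 2 / (d * k : ℕ)) ≤
      ∑ j, X ω j ^ 2} ≤ δ * Real.exp (-(a * d)) := by
  have hd : (0 : ℝ) < d := by exact_mod_cast Nat.pos_of_ne_zero (NeZero.ne d)
  have hk' : (0 : ℝ) < k := by exact_mod_cast Nat.pos_of_ne_zero hk
  set L := Real.log (1 / δ) with hL
  have hL0 : 0 ≤ L := Real.log_nonneg (by rw [le_div_iff₀ hδ]; linarith)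
  have hexp : Real.exp (-(L + a * d)) = δ * Real.exp (-(a * d)) := by
    rw [neg_add, Real.exp_add, hL, one_div, Real.log_inv, neg_neg, Real.exp_log hδ]
  rw [← hexp]
  -- The tail bound is used at level `L + a d`: `L` gives the factor `δ` and `a d` the extra
  -- exponential. By subadditivity of the square root, the extra deviation is at most `v d (2√a +
  -- 2a)`, which the margin `g` covers.
  refine le_trans (measureReal_mono fun ω hω => ?_)
    (hX.tail_le (by positivity) hm (x := L + a * d) (by positivity))
  refine le_trans (b := confRadius d s δ (d * k) ^ 2 + g * (s ^ 2 * (d : ℝ) ^ 2 / (d * k : ℕ)))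
    ?_ hω
  rw [confRadius_sq hδ hδ1, ← hL, Fintype.card_fin, Nat.cast_mul]
  set v := s ^ 2 / (k : ℝ) with hv
  have hv0 : 0 < v := by positivity
  have e : s ^ 2 * (d : ℝ) ^ 2 / (d * k) = v * d := by rw [hv]; field_simp
  rw [e]
  have h1 : d * √(1 / d * L) = √(d * L) := by
    have : (d : ℝ) * L = d ^ 2 * (1 / d * L) := by field_simp
    rw [this, Real.sqrt_mul (sq_nonneg _) (1 / d * L), Real.sqrt_sq hd.le]
  have h2 : √(d * (L + a * d)) ≤ √(d * L) + d * √a := by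
    rw [show (d : ℝ) * (L + a * d) = d * L + d ^ 2 * a by ring]
    rw [Real.sqrt_le_left (by positivity)]
    have h6 : √(d * L) ^ 2 = d * L := Real.sq_sqrt (by positivity)
    have h7 : √a ^ 2 = a := Real.sq_sqrt ha
    have h8 : 0 ≤ √(d * L) * (d * √a) := by positivity
    nlinarith
  have h3 : v * d * (1 + 2 * √(1 / d * L) + 2 / d * L) = v * (d + 2 * √(d * L) + 2 * L) := by
    rw [← h1]
    field_simp
  rw [h3]
  have h4 : v * d * (2 * √a + 2 * a) ≤ v * d * g := by gcongr
  show v * (d + 2 * √(d * (L + a * d)) + 2 * (L + a * d)) ≤ _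
  have h5 := mul_le_mul_of_nonneg_left h2 hv0.le
  linarith

/-- While the confidence radius is larger than a quarter of the norm of the parameter, the blocks
are short. -/
lemma blockLength_le_of_lt_confRadius {n : ℕ} {s H m q : ℝ} (hn : 0 < n)
    (hm : 0 < m) (hq : 0 < q) (hH : 0 < H) (hqm : q * m ^ 2 = s ^ 2 * (d : ℝ) ^ 2)
    (h : m / 4 < confRadius d s (min (d * n / H) 1) n) :
    (n : ℝ) ≤ 36 * (q * logBar (H / q)) := by
  have hd : (1 : ℝ) ≤ d := by exact_mod_cast Nat.pos_of_ne_zero (NeZero.ne d)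
  have hn' : (0 : ℝ) < n := by exact_mod_cast hn
  set δ := min (d * n / H) 1 with hδdef
  have hδ : 0 < δ := lt_min (by positivity) one_pos
  have hδ1 : δ ≤ 1 := min_le_right _ _
  have hΛ : 0 ≤ Real.log (max (H / q) 1) := Real.log_nonneg (le_max_right _ _)
  rw [logBar]
  set Λ := Real.log (max (H / q) 1) with hΛdef
  by_cases h16 : (n : ℝ) ≤ 16 * q
  · nlinarith [mul_nonneg hq.le hΛ]
  push Not at h16
  set L := Real.log (1 / δ) with hL
  have hL0 : 0 ≤ L := Real.log_nonneg (by rw [le_div_iff₀ hδ]; linarith)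
  have hsq : m ^ 2 / 16 < confRadius d s δ n ^ 2 := by
    have : (m / 4) ^ 2 < confRadius d s δ n ^ 2 := by gcongr
    linarith [show (m / 4) ^ 2 = m ^ 2 / 16 by ring]
  rw [confRadius_sq hδ hδ1, ← hL, ← hqm] at hsq
  -- From `(√L - 4)² ≥ 0`, that is `2√L ≤ L/4 + 4`. The constant `36` of the conclusion is `16 ·
  -- 9/4`.
  have h1 : 1 + 2 * √(1 / d * L) + 2 / d * L ≤ 5 + 9 / 4 * L := by
    have h2 : √(1 / d * L) ≤ √L := by
      refine Real.sqrt_le_sqrt (mul_le_of_le_one_left hL0 ?_)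
      rw [div_le_one (by linarith)]
      exact hd
    have h3 : 2 / d * L ≤ 2 * L := by
      refine mul_le_mul_of_nonneg_right ?_ hL0
      rw [div_le_iff₀ (by linarith)]
      linarith
    have h4 : √L ^ 2 = L := Real.sq_sqrt hL0
    nlinarith [sq_nonneg (√L - 4)]
  have h2 : m ^ 2 / 16 < q * m ^ 2 / n * (5 + 9 / 4 * L) :=
    hsq.trans_le (mul_le_mul_of_nonneg_left h1 (by positivity))
  have h3 : (n : ℝ) < 16 * q * (5 + 9 / 4 * L) := by
    have e : q * m ^ 2 / n * (5 + 9 / 4 * L) = m ^ 2 * (q * (5 + 9 / 4 * L) / n) := by ring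
    rw [e, div_eq_mul_inv] at h2
    have h4 := lt_of_mul_lt_mul_left h2 (by positivity)
    rw [lt_div_iff₀ hn'] at h4
    linarith
  -- For `δ < 1`, the assumption `n > 16q` gives `L ≤ Λ - log 16`, and this gain absorbs the
  -- constant `5`.
  have h4 : 5 + 9 / 4 * L ≤ 9 / 4 * (1 + Λ) ∨ L = 0 := by
    rcases min_choice (d * n / H) 1 with hc | hc
    · left
      have h5 : L = Real.log (H / (d * n)) := by rw [hL, hδdef, hc, one_div_div]
      have h6 : L ≤ Real.log (max (H / q) 1 / 16) := by
        rw [h5]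
        refine Real.log_le_log (by positivity) ?_
        have : H / q / 16 ≤ max (H / q) 1 / 16 := by gcongr; exact le_max_left _ _
        refine le_trans ?_ this
        rw [div_div]
        have h9 : q * 16 ≤ d * n := by nlinarith
        exact div_le_div_of_nonneg_left hH.le (by positivity) h9
      rw [Real.log_div (by positivity) (by norm_num), ← hΛdef] at h6
      have h7 : (5 / 4 + 3 / 2 : ℝ) ≤ Real.log 16 := by
        rw [show (16 : ℝ) = 2 ^ 4 by norm_num, Real.log_pow]
        have := Real.log_two_gt_d9
        push_cast
        linarith
      linarith
    · right
      rw [hL, hδdef, hc]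
      simp
  rcases h4 with h4 | h4
  · have := mul_le_mul_of_nonneg_left h4 hq.le
    linarith
  -- For `δ = 1` the squared radius is exactly `q m² / n`, and exceeding `m²/16` would mean `n <
  -- 16q`, already excluded.
  · have hδ' : δ = 1 := by
      have h5 : Real.log δ = 0 := by rw [hL, one_div, Real.log_inv] at h4; linarith
      rw [← Real.exp_log hδ, h5, Real.exp_zero]
    rw [h4] at hsq
    simp only [mul_zero, Real.sqrt_zero, add_zero, mul_one] at hsq
    rw [div_lt_div_iff₀ (by norm_num) hn'] at hsq
    nlinarith [sq_nonneg m, show 0 < m ^ 2 by positivity]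

/-- If the first estimate exceeding three confidence radii is off by the wrong factor, then its
error exceeds the confidence radius by a margin. -/
lemma margin_of_bad {m B U D E r : ℝ} (hm : 0 < m) (hB0 : 0 ≤ B) (hU : 0 ≤ U)
    (h1 : 3 * U < B) (h2 : B ≤ m + D) (h3 : m ≤ B + D) (hEU : E ≤ U ^ 2) (hr : m ^ 2 = r * E)
    (hbad : B < m / 2 ∨ 33 / 20 * m < B) :
    U ^ 2 + max (3 / 25 * r) (393 / 1000) * E ≤ D ^ 2 := by
  have hmax : max (3 / 25 * r) (393 / 1000) * E ≤ max (3 / 25 * m ^ 2) (393 / 1000 * E) := by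
    rcases max_choice (3 / 25 * r) (393 / 1000 : ℝ) with h | h
    · rw [h]; refine le_trans (le_of_eq ?_) (le_max_left _ _); rw [hr]; ring
    · rw [h]; exact le_max_right _ _
  have hU2 : 9 * U ^ 2 ≤ B ^ 2 := by nlinarith
  suffices h : U ^ 2 + 3 / 25 * m ^ 2 ≤ D ^ 2 ∧ U ^ 2 + 393 / 1000 * E ≤ D ^ 2 by
    have : max (3 / 25 * m ^ 2) (393 / 1000 * E) ≤ D ^ 2 - U ^ 2 :=
      max_le (by linarith [h.1]) (by linarith [h.2])
    linarith
  -- If `B < m/2`, then `D > m/2 > B > 3U` leaves ample room. If `B > 33m/20`, then `D ≥ 13B/33`,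
  -- and `B > 3U` gives `D² - U² ≥ (48/1089) B² ≥ (3/25) m²` as well as `D² ≥ (169/121) U²`, where
  -- `48/121 > 393/1000`.
  rcases hbad with hb | hb
  · constructor
    · nlinarith
    · nlinarith
  · have hD : 13 / 33 * B ≤ D := by linarith
    have hD' : B - m ≤ D := by linarith
    constructor
    · nlinarith
    · nlinarith

/-- Converts the margin of `margin_of_bad` into the exponential rate `17/2000`. Above the crossover
`r = 33/10` the constants add up exactly: `2 · 103/2000 + 2 · 17/2000 = 3/25`. -/
lemma margin_ge {r : ℝ} (hr : 0 ≤ r) :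
    2 * √(17 / 2000 * r) + 2 * (17 / 2000 * r) ≤ max (3 / 25 * r) (393 / 1000) := by
  rcases le_total r (33 / 10) with h | h
  · refine le_trans ?_ (le_max_right _ _)
    have : √(17 / 2000 * r) ≤ 168 / 1000 := by
      rw [Real.sqrt_le_left (by norm_num)]
      linarith
    linarith
  · refine le_trans ?_ (le_max_left _ _)
    have : √(17 / 2000 * r) ≤ 103 / 2000 * r := by
      rw [Real.sqrt_le_left (by positivity)]
      nlinarith
    linarith

end Radius

/-! ### Regret along a noise sequence -/

section CommitRegret

variable {d : ℕ} {A : Matrix (Fin d) (Fin d) ℝ} {xs : (Fin d → ℝ) → (Fin d → ℝ)}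

/-- The regret of a round after committing on the estimate with coordinates `p = A^{1/2} θ̂`. -/
noncomputable def commitRegret (A : Matrix (Fin d) (Fin d) ℝ) (xs : (Fin d → ℝ) → (Fin d → ℝ))
    (θ p : Fin d → ℝ) : ℝ :=
  matNorm A θ - xs ((CFC.sqrt A)⁻¹ *ᵥ p) ⬝ᵥ θ

lemma inv_sqrt_mulVec (hA : A.PosDef) (v : Fin d → ℝ) :
    (CFC.sqrt A)⁻¹ *ᵥ (CFC.sqrt A *ᵥ v) = v := by
  rw [mulVec_mulVec, nonsing_inv_mul _ (isUnit_sqrt hA), one_mulVec]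

lemma sqrt_mulVec_inv (hA : A.PosDef) (v : Fin d → ℝ) :
    CFC.sqrt A *ᵥ ((CFC.sqrt A)⁻¹ *ᵥ v) = v := by
  rw [mulVec_mulVec, mul_nonsing_inv _ (isUnit_sqrt hA), one_mulVec]

lemma matNorm_nonneg (A : Matrix (Fin d) (Fin d) ℝ) (v : Fin d → ℝ) : 0 ≤ matNorm A v :=
  Real.sqrt_nonneg _

lemma commitRegret_mem (hA : A.PosDef) (hxs : ∀ v, IsArgmax (ellipsoid 0 A) v (xs v))
    (θ p : Fin d → ℝ) : commitRegret A xs θ p ∈ Set.Icc 0 (2 * matNorm A θ) := by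
  have := abs_le.1 (abs_dotProduct_le hA (hxs ((CFC.sqrt A)⁻¹ *ᵥ p)).1 θ)
  constructor <;> rw [commitRegret] <;> linarith [this.1, this.2]

lemma commitRegret_eq (hA : A.PosDef) (hxs : ∀ v, IsArgmax (ellipsoid 0 A) v (xs v))
    (θ : Fin d → ℝ) {p : Fin d → ℝ} (hp : p ≠ 0) :
    commitRegret A xs θ p =
      matNorm A θ - (√(∑ j, p j ^ 2))⁻¹ * (p ⬝ᵥ (CFC.sqrt A *ᵥ θ)) := by
  have hnorm : matNorm A ((CFC.sqrt A)⁻¹ *ᵥ p) = √(∑ j, p j ^ 2) := by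
    rw [matNorm_eq hA, sqrt_mulVec_inv hA]
  have hpos : 0 < √(∑ j, p j ^ 2) := by
    obtain ⟨j, hj⟩ := Function.ne_iff.1 hp
    exact Real.sqrt_pos.2 (Finset.sum_pos' (fun _ _ => sq_nonneg _)
      ⟨j, Finset.mem_univ _, by have : p j ≠ 0 := hj; positivity⟩)
  rw [commitRegret, (hxs _).eq_of_pos hA (by rwa [hnorm]), hnorm, sqrt_mulVec_inv hA,
    sqrt_mulVec_dotProduct, smul_dotProduct, smul_eq_mul]

/-- The selection `xs` may be non-measurable, but the maximizer is unique unless `p = 0`, so its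
arbitrariness affects a single point. -/
lemma measurable_commitRegret (hA : A.PosDef) (hxs : ∀ v, IsArgmax (ellipsoid 0 A) v (xs v))
    (θ : Fin d → ℝ) : Measurable (commitRegret A xs θ) := by
  classical
  have h : commitRegret A xs θ = fun p => if p = 0 then commitRegret A xs θ 0 else
      matNorm A θ - (√(∑ j, p j ^ 2))⁻¹ * (p ⬝ᵥ (CFC.sqrt A *ᵥ θ)) := by
    funext p
    split_ifs with hp
    · rw [hp]
    · exact commitRegret_eq hA hxs θ hp
  rw [h]
  refine Measurable.ite (measurableSet_singleton (0 : Fin d → ℝ)) measurable_const ?_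
  unfold dotProduct
  fun_prop

/-- Committing on an accurate estimate costs at most the squared error over `‖θ‖_A`. -/
lemma commitRegret_le (hA : A.PosDef) (hxs : ∀ v, IsArgmax (ellipsoid 0 A) v (xs v))
    {θ e : Fin d → ℝ} (hm : 0 < matNorm A θ) (he : ∑ j, e j ^ 2 < matNorm A θ ^ 2) :
    commitRegret A xs θ (CFC.sqrt A *ᵥ θ + e) ≤ (∑ j, e j ^ 2) / matNorm A θ := by
  set m := matNorm A θ with hmdef
  set w := CFC.sqrt A *ᵥ θ with hw
  have hm2 : ∑ j, w j ^ 2 = m ^ 2 := by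
    rw [hmdef, matNorm_eq hA, Real.sq_sqrt (Finset.sum_nonneg fun _ _ => sq_nonneg _)]
  set p := w + e with hp
  set P := √(∑ j, p j ^ 2) with hP
  have hP2 : P ^ 2 = ∑ j, p j ^ 2 := Real.sq_sqrt (Finset.sum_nonneg fun _ _ => sq_nonneg _)
  have hP0 : 0 ≤ P := Real.sqrt_nonneg _
  set x := p ⬝ᵥ w with hx
  have hexp : ∑ j, e j ^ 2 = P ^ 2 - 2 * x + m ^ 2 := by
    rw [hP2, ← hm2, hx, dotProduct, Finset.mul_sum, ← Finset.sum_sub_distrib,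
      ← Finset.sum_add_distrib]
    refine Finset.sum_congr rfl fun j _ => ?_
    simp only [hp, Pi.add_apply]
    ring
  have hxpos : 0 < x := by nlinarith [sq_nonneg P]
  have hPpos : 0 < P := by
    rcases hP0.lt_or_eq with h | h
    · exact h
    · have : x ^ 2 ≤ P ^ 2 * m ^ 2 := by rw [hP2, ← hm2]; exact sq_dotProduct_le _ _
      rw [← h] at this
      nlinarith
  have hpne : p ≠ 0 := by
    rintro h
    rw [hP, h] at hPpos
    simp at hPpos
  rw [commitRegret_eq hA hxs θ hpne, ← hmdef, ← hP, ← hw, ← hx, hexp, le_div_iff₀ hm]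
  -- `y` is the reward of the committed action. The claim `(m - y) m ≤ P² - 2Py + m²` amounts to `(P
  -- - y)² + y (m - y) ≥ 0`.
  set y := P⁻¹ * x with hy
  have hxy : x = P * y := by rw [hy]; field_simp
  have hy0 : 0 < y := by positivity
  have hym : y ≤ m := by
    have h1 : x ^ 2 ≤ P ^ 2 * m ^ 2 := by rw [hP2, ← hm2]; exact sq_dotProduct_le _ _
    have h2 : x ≤ P * m := by
      rw [← mul_pow] at h1
      exact le_of_sq_le_sq h1 (by positivity)
    rw [hxy] at h2
    exact le_of_mul_le_mul_left h2 hPpos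
  rw [hxy]
  nlinarith [sq_nonneg (P - y), mul_nonneg hy0.le (sub_nonneg.2 hym)]

end CommitRegret

/-! ### Outcomes of the warm-up and decomposition of the regret -/

section Path

variable {d : ℕ} [NeZero d] {A : Matrix (Fin d) (Fin d) ℝ} {xs : (Fin d → ℝ) → (Fin d → ℝ)}
  {c θ : Fin d → ℝ} {σ T : ℝ} {ζ z : ℕ → ℝ}

lemma blockEnd_succ (d i : ℕ) : blockEnd d (i + 1) = blockEnd d i + d * 2 ^ i := by
  rw [blockEnd, blockEnd, ← mul_add]
  congr 1
  have := Nat.one_le_two_pow (n := i)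
  rw [pow_succ]
  omega

lemma dvd_blockEnd (d i : ℕ) : d ∣ blockEnd d i := Dvd.intro _ rfl

lemma le_blockEnd (i : ℕ) : i ≤ blockEnd d i := by
  have h1 : i < 2 ^ i := Nat.lt_two_pow_self
  have h2 : 1 ≤ d := NeZero.one_le
  have h3 : 1 * (2 ^ i - 1) ≤ d * (2 ^ i - 1) := Nat.mul_le_mul_right _ h2
  rw [blockEnd]
  omega

lemma avg_exploreObs {a k : ℕ} (ha : d ∣ a) (hk : k ≠ 0) :
    avg d a k (exploreObs A θ ζ) = CFC.sqrt A *ᵥ θ + avg d a k ζ := by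
  have : exploreObs A θ ζ = (fun t => (CFC.sqrt A *ᵥ θ) (Fin.ofNat d t)) + ζ := rfl
  rw [this, avg_add, avg_periodic ha hk]

/-- The error of the estimate from the `i`-th warm-up block. -/
noncomputable def blockNoise (d i : ℕ) (ζ : ℕ → ℝ) : Fin d → ℝ :=
  avg d (blockEnd d (i - 1)) (2 ^ (i - 1)) ζ

lemma blockNorm_exploreObs (hA : A.PosDef) {i : ℕ} (hi : 1 ≤ i) :
    blockNorm A (exploreObs A θ ζ) i =
      √(∑ j, (CFC.sqrt A *ᵥ θ + blockNoise d i ζ) j ^ 2) := by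
  obtain ⟨i, rfl⟩ : ∃ n, i = n + 1 := ⟨i - 1, by omega⟩
  rw [blockNorm, Nat.add_sub_cancel, blockEnd_succ, matNorm_estimate hA (dvd_blockEnd d i)
    (by positivity), avg_exploreObs (dvd_blockEnd d i) (by positivity), blockNoise,
    Nat.add_sub_cancel]

/-- The confidence radius of the `i`-th warm-up block. -/
noncomputable def blockRadius (d : ℕ) (σ T : ℝ) (i : ℕ) : ℝ :=
  confRadius d (√2 * σ) (blockDelta d (T / 2) i) (blockLength d i)

/-- The `i`-th warm-up block passes the stopping test. -/
def Passes (A : Matrix (Fin d) (Fin d) ℝ) (θ : Fin d → ℝ) (σ T : ℝ) (i : ℕ) (ζ : ℕ → ℝ) : Prop :=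
  3 * blockRadius d σ T i < blockNorm A (exploreObs A θ ζ) i

/-- No warm-up block up to the `i`-th one passes the stopping test. -/
def NoneEnds (A : Matrix (Fin d) (Fin d) ℝ) (θ : Fin d → ℝ) (σ T : ℝ) (i : ℕ) (ζ : ℕ → ℝ) :
    Prop :=
  ∀ j, 1 ≤ j → j ≤ i → ¬ Passes A θ σ T j ζ

/-- Warm-up ends after the `i`-th block. -/
def EndsAt (A : Matrix (Fin d) (Fin d) ℝ) (θ : Fin d → ℝ) (σ T : ℝ) (i : ℕ) (ζ : ℕ → ℝ) :
    Prop :=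
  1 ≤ i ∧ Passes A θ σ T i ζ ∧ NoneEnds A θ σ T (i - 1) ζ

lemma warmupEnds_iff {i : ℕ} :
    WarmupEnds A 3 (√2 * σ) (T / 2) (exploreObs A θ ζ) i ↔ EndsAt A θ σ T i ζ := by
  constructor
  · rintro ⟨⟨h1, h2⟩, h3⟩
    refine ⟨h1, h2, fun j hj hji hp => ?_⟩
    have := h3 (show j ∈ _ from ⟨hj, hp⟩)
    omega
  · rintro ⟨h1, h2, h3⟩
    refine ⟨⟨h1, h2⟩, fun j hj => ?_⟩
    by_contra h
    exact h3 j hj.1 (by omega) hj.2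

lemma EndsAt.unique {i j : ℕ} (hi : EndsAt A θ σ T i ζ) (hj : EndsAt A θ σ T j ζ) : i = j :=
  (warmupEnds_iff.2 hi).unique (warmupEnds_iff.2 hj)

lemma exists_endsAt {i : ℕ} (h : ¬ NoneEnds A θ σ T i ζ) : ∃ j ≤ i, EndsAt A θ σ T j ζ := by
  classical
  simp only [NoneEnds, not_forall, not_not] at h
  have hex : ∃ j, 1 ≤ j ∧ Passes A θ σ T j ζ := by
    obtain ⟨j, h1, _, h2⟩ := h
    exact ⟨j, h1, h2⟩
  refine ⟨Nat.find hex, ?_, (Nat.find_spec hex).1, (Nat.find_spec hex).2, ?_⟩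
  · obtain ⟨j, h1, h2, h3⟩ := h
    exact (Nat.find_min' hex ⟨h1, h3⟩).trans h2
  · intro j h1 h2 h3
    have := Nat.find_min' hex ⟨h1, h3⟩
    have := (Nat.find_spec hex).1
    omega

/-- The number of round-robin cycles of the second exploration phase. -/
noncomputable def cycles (A : Matrix (Fin d) (Fin d) ℝ) (θ : Fin d → ℝ) (σ T : ℝ) (i : ℕ)
    (ζ : ℕ → ℝ) : ℕ :=
  ⌈√2 * σ * √(T / 2) / blockNorm A (exploreObs A θ ζ) i⌉₊

lemma exploreEnd_exploreObs (i : ℕ) :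
    exploreEnd A (√2 * σ) (T / 2) (exploreObs A θ ζ) i = blockEnd d i + d * cycles A θ σ T i ζ :=
  rfl

lemma EndsAt.blockNorm_pos {i : ℕ} (h : EndsAt A θ σ T i ζ) :
    0 < blockNorm A (exploreObs A θ ζ) i := by
  have h1 : 3 * blockRadius d σ T i < _ := h.2.1
  have h2 : 0 ≤ blockRadius d σ T i := confRadius_nonneg
  linarith

lemma sqrt_two_mul_sqrt (σ T : ℝ) : √2 * σ * √(T / 2) = σ * √T := by
  rw [mul_comm (√2), mul_assoc, ← Real.sqrt_mul (by norm_num)]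
  congr 2
  ring

lemma EndsAt.cycles_ne_zero (hσ : 0 < σ) (hT : 0 < T) {i : ℕ} (h : EndsAt A θ σ T i ζ) :
    cycles A θ σ T i ζ ≠ 0 := by
  have := h.blockNorm_pos
  rw [cycles, ← Nat.pos_iff_ne_zero, Nat.ceil_pos]
  positivity

/-- The regret of an exploration round. -/
noncomputable def exploreRegret (A : Matrix (Fin d) (Fin d) ℝ) (θ : Fin d → ℝ) (t : ℕ) : ℝ :=
  matNorm A θ - if t % 2 = 0 then 0 else roundRobin A (t / 2) ⬝ᵥ θ

/-- The largest possible regret of an exploration round. -/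
noncomputable def exploreCost (m : ℝ) (t : ℕ) : ℝ := if t % 2 = 0 then m else 2 * m

lemma exploreRegret_mem (hA : A.PosDef) (t : ℕ) :
    exploreRegret A θ t ∈ Set.Icc 0 (exploreCost (matNorm A θ) t) := by
  have := abs_le.1 (abs_dotProduct_le hA (roundRobin_mem hA (t / 2)) θ)
  have h0 := matNorm_nonneg A θ
  rw [exploreRegret, exploreCost]
  split_ifs <;> constructor <;> linarith [this.1, this.2]

lemma exploreCost_le {m : ℝ} (hm : 0 ≤ m) (t : ℕ) : exploreCost m t ≤ 2 * m := by
  rw [exploreCost]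
  split_ifs <;> linarith

lemma exploreCost_nonneg {m : ℝ} (hm : 0 ≤ m) (t : ℕ) : 0 ≤ exploreCost m t := by
  rw [exploreCost]
  split_ifs <;> linarith

variable {xopt : Fin d → ℝ}

lemma regret_explore (hA : A.PosDef) (hxopt : IsArgmax (ellipsoid c A) θ xopt) {t : ℕ}
    (h : ∀ i, EndsAt A θ σ T i (pairDiff z) →
      t / 2 < blockEnd d i + d * cycles A θ σ T i (pairDiff z)) :
    xopt ⬝ᵥ θ - action (translatedE2TC c A xs 3 σ T) θ z t ⬝ᵥ θ = exploreRegret A θ t := by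
  rw [action_explore fun i hi => by
    rw [exploreEnd_exploreObs]; exact h i (warmupEnds_iff.1 hi), hxopt.dotProduct_eq hA,
    exploreRegret]
  split_ifs
  · ring
  · rw [add_dotProduct]; ring

lemma regret_commit (hA : A.PosDef) (hxopt : IsArgmax (ellipsoid c A) θ xopt) (hσ : 0 < σ)
    (hT : 0 < T) {t i : ℕ} (hi : EndsAt A θ σ T i (pairDiff z))
    (ht : blockEnd d i + d * cycles A θ σ T i (pairDiff z) ≤ t / 2) :
    xopt ⬝ᵥ θ - action (translatedE2TC c A xs 3 σ T) θ z t ⬝ᵥ θ =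
      commitRegret A xs θ (CFC.sqrt A *ᵥ θ +
        avg d (blockEnd d i) (cycles A θ σ T i (pairDiff z)) (pairDiff z)) := by
  have hk := hi.cycles_ne_zero hσ hT
  rw [action_commit (warmupEnds_iff.2 hi) (by rwa [exploreEnd_exploreObs]),
    hxopt.dotProduct_eq hA, exploreEnd_exploreObs, commitRegret,
    ← avg_exploreObs (dvd_blockEnd d i) hk, ← sqrt_mulVec_estimate hA (dvd_blockEnd d i) hk,
    inv_sqrt_mulVec hA, add_dotProduct]
  ring

/-- An exploration action takes two rounds: the centre costs `m` and the translated action at most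
`2m`, together `3m`. A phase is charged in full if it starts before round `T`, and not at all
otherwise. -/
lemma sum_exploreCost_le {m : ℝ} (hm : 0 ≤ m) (a b T : ℕ) :
    ∑ t ∈ Finset.range T, (if a ≤ t / 2 ∧ t / 2 < a + b then exploreCost m t else 0) ≤
      if 2 * a < T then 3 * m * b else 0 := by
  have hfull : ∑ t ∈ Finset.Ico (2 * a) (2 * (a + b)), exploreCost m t = 3 * m * b := by
    induction b with
    | zero => simp
    | succ b ih =>
      rw [show 2 * (a + (b + 1)) = 2 * (a + b) + 1 + 1 by ring, Finset.sum_Ico_succ_top (by omega),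
        Finset.sum_Ico_succ_top (by omega), ih, exploreCost, exploreCost, if_pos (by omega),
        if_neg (by omega)]
      push_cast
      ring
  split_ifs with h
  · rw [← hfull, ← Finset.sum_filter]
    refine Finset.sum_le_sum_of_subset_of_nonneg ?_ fun t _ _ => exploreCost_nonneg hm t
    intro t ht
    have := (Finset.mem_filter.1 ht).2
    rw [Finset.mem_Ico]
    omega
  · refine le_of_eq (Finset.sum_eq_zero fun t ht => if_neg ?_)
    have := Finset.mem_range.1 ht
    omega

omit [NeZero d] in
lemma sum_warmupCost_le {m : ℝ} (hm : 0 ≤ m) (I T : ℕ) :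
    ∑ t ∈ Finset.range T, (if t / 2 < blockEnd d I then exploreCost m t else 0) ≤
      ∑ i ∈ Finset.range I, if 2 * blockEnd d i < T then 3 * m * (d * 2 ^ i) else 0 := by
  induction I with
  | zero => simp [blockEnd]
  | succ I ih =>
    rw [Finset.sum_range_succ]
    have h := sum_exploreCost_le hm (blockEnd d I) (d * 2 ^ I) T
    push_cast at h
    refine le_trans (le_of_eq ?_) (add_le_add ih h)
    rw [← Finset.sum_add_distrib]
    refine Finset.sum_congr rfl fun t _ => ?_
    rw [blockEnd_succ]
    by_cases h1 : t / 2 < blockEnd d I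
    · rw [if_pos h1, if_pos (by omega), if_neg (by omega), add_zero]
    · rw [if_neg h1, zero_add]
      by_cases h2 : t / 2 < blockEnd d I + d * 2 ^ I
      · rw [if_pos h2, if_pos ⟨by omega, h2⟩]
      · rw [if_neg h2, if_neg (by omega)]

/-- Warm-up ends after block `i` with an estimate of `‖θ‖_A` that is off by a large factor. -/
def BadEnd (A : Matrix (Fin d) (Fin d) ℝ) (θ : Fin d → ℝ) (σ T : ℝ) (i : ℕ) (ζ : ℕ → ℝ) : Prop :=
  EndsAt A θ σ T i ζ ∧ (blockNorm A (exploreObs A θ ζ) i < matNorm A θ / 2 ∨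
    33 / 20 * matNorm A θ < blockNorm A (exploreObs A θ ζ) i)

/-- Warm-up ends after block `i` with a good estimate of `‖θ‖_A`, and `k` exploration cycles
follow. -/
def GoodEnd (A : Matrix (Fin d) (Fin d) ℝ) (θ : Fin d → ℝ) (σ T : ℝ) (i k : ℕ) (ζ : ℕ → ℝ) :
    Prop :=
  EndsAt A θ σ T i ζ ∧ cycles A θ σ T i ζ = k ∧
    matNorm A θ / 2 ≤ blockNorm A (exploreObs A θ ζ) i ∧
    blockNorm A (exploreObs A θ ζ) i ≤ 33 / 20 * matNorm A θ

open Classical in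
/-- The regret along a noise sequence, split according to the outcome of the warm-up. -/
lemma pathRegret_le (hA : A.PosDef) (hxs : ∀ v, IsArgmax (ellipsoid 0 A) v (xs v))
    (hxopt : IsArgmax (ellipsoid c A) θ xopt) (hσ : 0 < σ) {N K : ℕ} (hN : 0 < N)
    (hm : 0 < matNorm A θ) (hK : 2 * (σ * √N) / matNorm A θ ≤ K) :
    pathRegret (translatedE2TC c A xs 3 σ N) θ xopt N z ≤
      (∑ i ∈ Finset.range N, if 2 * blockEnd d i < N ∧ NoneEnds A θ σ N i (pairDiff z)
        then 3 * matNorm A θ * (d * 2 ^ i) else 0) +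
      ∑ i ∈ Finset.Icc 1 N, ((if BadEnd A θ σ N i (pairDiff z) then 2 * matNorm A θ * N else 0) +
        ∑ k ∈ Finset.Icc 1 K, if GoodEnd A θ σ N i k (pairDiff z) then
          3 * matNorm A θ * (d * k : ℕ) + N * commitRegret A xs θ
            (CFC.sqrt A *ᵥ θ + avg d (blockEnd d i) k (pairDiff z)) else 0) := by
  set m := matNorm A θ with hmdef
  set ζ := pairDiff z with hζ
  have hN' : (0 : ℝ) < N := by exact_mod_cast hN
  have hcr := commitRegret_mem hA hxs θ
  have hgood0 : ∀ i k, 0 ≤ if GoodEnd A θ σ N i k ζ then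
      3 * m * (d * k : ℕ) + N * commitRegret A xs θ
        (CFC.sqrt A *ᵥ θ + avg d (blockEnd d i) k ζ) else 0 := by
    intro i k
    split_ifs
    · have := (hcr (CFC.sqrt A *ᵥ θ + avg d (blockEnd d i) k ζ)).1
      positivity
    · exact le_rfl
  have hbad0 : ∀ i, 0 ≤ if BadEnd A θ σ N i ζ then 2 * m * (N : ℝ) else 0 := by
    intro i
    split_ifs <;> positivity
  set F : ℕ → ℝ := fun i => (if BadEnd A θ σ N i ζ then 2 * m * (N : ℝ) else 0) +
      ∑ k ∈ Finset.Icc 1 K, if GoodEnd A θ σ N i k ζ then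
        3 * m * (d * k : ℕ) + N * commitRegret A xs θ
          (CFC.sqrt A *ᵥ θ + avg d (blockEnd d i) k ζ) else 0 with hF
  have hF0 : ∀ i, 0 ≤ F i := fun i =>
    add_nonneg (hbad0 i) (Finset.sum_nonneg fun k _ => hgood0 i k)
  have hwarm : ∀ I ≤ N, (∀ i < I, NoneEnds A θ σ N i ζ) →
      ∑ t ∈ Finset.range N, (if t / 2 < blockEnd d I then exploreCost m t else 0) ≤
      ∑ i ∈ Finset.range N, if 2 * blockEnd d i < N ∧ NoneEnds A θ σ N i ζ
        then 3 * m * (d * 2 ^ i) else 0 := by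
    intro I hI hnone
    refine (sum_warmupCost_le hm.le I N).trans ?_
    have hsub : Finset.range I ⊆ Finset.range N := Finset.range_mono hI
    refine le_trans (Finset.sum_le_sum fun i hi => ?_)
      (Finset.sum_le_sum_of_subset_of_nonneg hsub fun i _ _ => ?_)
    · have := hnone i (Finset.mem_range.1 hi)
      simp only [this, and_true]
      exact le_rfl
    · split_ifs <;> positivity
  -- Ends after a block `I > N` need no treatment: `I ≤ blockEnd d I` puts them beyond the `N`
  -- rounds.
  by_cases hex : ∃ I ≤ N, EndsAt A θ σ N I ζ
  · obtain ⟨I, hIN, hI⟩ := hex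
    set k := cycles A θ σ N I ζ with hkdef
    have hnone : ∀ i < I, NoneEnds A θ σ N i ζ := fun i hi j h1 h2 => hI.2.2 j h1 (by omega)
    have hsingle : F I ≤ ∑ i ∈ Finset.Icc 1 N, F i :=
      Finset.single_le_sum (fun i _ => hF0 i) (Finset.mem_Icc.2 ⟨hI.1, hIN⟩)
    refine le_trans ?_ (add_le_add (hwarm I hIN hnone) hsingle)
    have hk0 : k ≠ 0 := hI.cycles_ne_zero hσ hN'
    set r := commitRegret A xs θ (CFC.sqrt A *ᵥ θ + avg d (blockEnd d I) k ζ) with hr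
    have hstep : ∀ t, xopt ⬝ᵥ θ - action (translatedE2TC c A xs 3 σ N) θ z t ⬝ᵥ θ =
        if t / 2 < blockEnd d I + d * k then exploreRegret A θ t else r := by
      intro t
      split_ifs with ht
      · refine regret_explore hA hxopt fun i hi => ?_
        obtain rfl := hi.unique hI
        exact ht
      · exact regret_commit hA hxopt hσ hN' hI (not_lt.1 ht)
    rw [pathRegret, Finset.sum_congr rfl fun t _ => hstep t]
    by_cases hb : BadEnd A θ σ N I ζ
    · have hFI : 2 * m * N ≤ F I := by
        simp only [hF]
        rw [if_pos hb]
        have := Finset.sum_nonneg fun k (_ : k ∈ Finset.Icc 1 K) => hgood0 I k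
        linarith
      have h2 : ∑ t ∈ Finset.range N, (2 * m) = 2 * m * N := by
        rw [Finset.sum_const, Finset.card_range, nsmul_eq_mul]; ring
      refine le_trans ?_ (add_le_add_right (h2.le.trans hFI) _)
      rw [← Finset.sum_add_distrib]
      refine Finset.sum_le_sum fun t _ => ?_
      have h3 := exploreRegret_mem (θ := θ) hA t
      have h4 := exploreCost_nonneg hm.le t
      have h5 := exploreCost_le hm.le t
      have h6 := hcr (CFC.sqrt A *ᵥ θ + avg d (blockEnd d I) k ζ)
      rw [← hr] at h6
      split_ifs <;> linarith [h3.1, h3.2, h6.1, h6.2]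
    · have hg : GoodEnd A θ σ N I k ζ := by
        simp only [BadEnd, not_and, not_or, not_lt] at hb
        exact ⟨hI, rfl, hb hI⟩
      -- A good end has `B ≥ m/2`, hence `k ≤ ⌈2σ√N/m⌉`: only finitely many values of `k` occur.
      have hkK : k ≤ K := by
        rw [hkdef, cycles, Nat.ceil_le, sqrt_two_mul_sqrt]
        refine le_trans ?_ hK
        rw [div_le_div_iff₀ hI.blockNorm_pos hm]
        have h1 : 0 ≤ σ * √(N : ℝ) := by positivity
        nlinarith [hg.2.2.1]
      have hFI : 3 * m * (d * k : ℕ) + N * r ≤ F I := by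
        simp only [hF]
        rw [if_neg hb, zero_add]
        refine le_trans (le_of_eq ?_) (Finset.single_le_sum (fun k _ => hgood0 I k)
          (Finset.mem_Icc.2 ⟨Nat.pos_of_ne_zero hk0, hkK⟩))
        rw [if_pos hg]
      have hex2 := sum_exploreCost_le hm.le (blockEnd d I) (d * k) N
      have hex3 : (if 2 * blockEnd d I < N then 3 * m * ((d * k : ℕ) : ℝ) else 0) ≤
          3 * m * (d * k : ℕ) := by
        split_ifs
        · exact le_rfl
        · positivity
      have h2 : ∑ t ∈ Finset.range N, r = N * r := by
        rw [Finset.sum_const, Finset.card_range, nsmul_eq_mul]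
      refine le_trans ?_ (add_le_add_right
        ((add_le_add (hex2.trans hex3) h2.le).trans hFI) _)
      rw [← Finset.sum_add_distrib, ← Finset.sum_add_distrib]
      refine Finset.sum_le_sum fun t _ => ?_
      have h3 := exploreRegret_mem (θ := θ) hA t
      have h4 := exploreCost_nonneg hm.le t
      have h6 := hcr (CFC.sqrt A *ᵥ θ + avg d (blockEnd d I) k ζ)
      rw [← hr] at h6
      by_cases h7 : t / 2 < blockEnd d I
      · rw [if_pos h7, if_pos (by omega), if_neg (by omega)]
        linarith [h3.2, h6.1]
      · rw [if_neg h7]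
        by_cases h8 : t / 2 < blockEnd d I + d * k
        · rw [if_pos h8, if_pos ⟨by omega, h8⟩]
          linarith [h3.2, h6.1]
        · rw [if_neg h8, if_neg (by omega)]
          linarith
  · push Not at hex
    have hnone : ∀ i < N, NoneEnds A θ σ N i ζ := by
      intro i hi
      by_contra h
      obtain ⟨j, hj, hj'⟩ := exists_endsAt h
      exact hex j (by omega) hj'
    refine le_trans ?_ (add_le_add (hwarm N le_rfl hnone) (Finset.sum_nonneg fun i _ => hF0 i))
    rw [add_zero, pathRegret]
    refine Finset.sum_le_sum fun t ht => ?_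
    have ht' : t / 2 < N := by have := Finset.mem_range.1 ht; omega
    have hNb := le_blockEnd (d := d) N
    rw [if_pos (by omega), regret_explore hA hxopt]
    · exact (exploreRegret_mem hA t).2
    · intro i hi
      have h1 : N < i := by
        by_contra h
        exact hex i (by omega) hi
      have h2 := le_blockEnd (d := d) i
      omega

end Path

/-! ### Probabilities of the outcomes of the warm-up -/

section Outcomes

variable {d : ℕ} [NeZero d] {A : Matrix (Fin d) (Fin d) ℝ} {θ : Fin d → ℝ} {σ T : ℝ}

omit [NeZero d] in
lemma sqrt_sum_add_sq_le (u v : Fin d → ℝ) :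
    √(∑ j, (u + v) j ^ 2) ≤ √(∑ j, u j ^ 2) + √(∑ j, v j ^ 2) := by
  have h := norm_add_le (WithLp.toLp 2 u) (WithLp.toLp 2 v)
  rw [← WithLp.toLp_add] at h
  simpa [EuclideanSpace.norm_eq] using h

/-- The norm of the error of the estimate from the `i`-th warm-up block controls the error of the
estimate of `‖θ‖_A`. -/
lemma blockNorm_exploreObs_bounds (hA : A.PosDef) {i : ℕ} (hi : 1 ≤ i) (ζ : ℕ → ℝ) :
    blockNorm A (exploreObs A θ ζ) i ≤ matNorm A θ + √(∑ j, blockNoise d i ζ j ^ 2) ∧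
      matNorm A θ ≤ blockNorm A (exploreObs A θ ζ) i + √(∑ j, blockNoise d i ζ j ^ 2) := by
  rw [blockNorm_exploreObs hA hi, matNorm_eq hA]
  refine ⟨sqrt_sum_add_sq_le _ _, ?_⟩
  have h := sqrt_sum_add_sq_le (CFC.sqrt A *ᵥ θ + blockNoise d i ζ) (-blockNoise d i ζ)
  simpa [add_neg_cancel_right] using h

lemma blockNorm_exploreObs_past (hA : A.PosDef) {i j : ℕ} (hi : 1 ≤ i) (hij : i ≤ j)
    (ζ : ℕ → ℝ) : blockNorm A (exploreObs A θ (past (blockEnd d j) ζ)) i =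
      blockNorm A (exploreObs A θ ζ) i := by
  obtain ⟨i, rfl⟩ : ∃ n, i = n + 1 := ⟨i - 1, by omega⟩
  have h : blockNoise d (i + 1) (past (blockEnd d j) ζ) = blockNoise d (i + 1) ζ := by
    refine avg_congr fun t _ ht => past_apply _ (ht.trans_le ?_)
    rw [Nat.add_sub_cancel, ← blockEnd_succ]
    exact blockEnd_mono d hij
  rw [blockNorm_exploreObs hA hi, blockNorm_exploreObs hA hi, h]

/-- A good end is decided by the observations before the second phase; this makes it independent of
the estimate used for committing. -/
lemma goodEnd_past (hA : A.PosDef) {i k : ℕ} (ζ : ℕ → ℝ) :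
    GoodEnd A θ σ T i k (past (blockEnd d i) ζ) ↔ GoodEnd A θ σ T i k ζ := by
  by_cases hi : 1 ≤ i
  · have h1 := blockNorm_exploreObs_past (θ := θ) hA hi le_rfl ζ
    have h2 : EndsAt A θ σ T i (past (blockEnd d i) ζ) ↔ EndsAt A θ σ T i ζ := by
      simp only [EndsAt, Passes, NoneEnds, h1]
      refine and_congr_right fun _ => and_congr_right fun _ => ?_
      refine forall_congr' fun j => forall_congr' fun hj => forall_congr' fun hji => ?_
      rw [blockNorm_exploreObs_past hA hj (by omega)]
    simp only [GoodEnd, cycles, h1, h2]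
  · constructor <;> intro h <;> exact absurd h.1.1 hi

lemma measurable_blockNorm_exploreObs (hA : A.PosDef) {i : ℕ} (hi : 1 ≤ i) :
    Measurable fun ζ : ℕ → ℝ => blockNorm A (exploreObs A θ ζ) i := by
  simp_rw [blockNorm_exploreObs hA hi]
  unfold blockNoise
  have := measurable_avg (d := d) (blockEnd d (i - 1)) (2 ^ (i - 1))
  simp only [Pi.add_apply]
  fun_prop

lemma measurableSet_passes (hA : A.PosDef) {i : ℕ} (hi : 1 ≤ i) :
    MeasurableSet {ζ : ℕ → ℝ | Passes A θ σ T i ζ} :=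
  measurableSet_lt measurable_const (measurable_blockNorm_exploreObs hA hi)

lemma measurableSet_noneEnds (hA : A.PosDef) (i : ℕ) :
    MeasurableSet {ζ : ℕ → ℝ | NoneEnds A θ σ T i ζ} := by
  simp only [NoneEnds, Set.ofPred_forall]
  exact MeasurableSet.iInter fun j => MeasurableSet.iInter fun hj => MeasurableSet.iInter fun _ =>
    (measurableSet_passes hA hj).compl

lemma measurableSet_endsAt (hA : A.PosDef) (i : ℕ) :
    MeasurableSet {ζ : ℕ → ℝ | EndsAt A θ σ T i ζ} := by
  by_cases hi : 1 ≤ i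
  · simp only [EndsAt, hi, true_and]
    exact (measurableSet_passes hA hi).inter (measurableSet_noneEnds hA _)
  · simp [EndsAt, hi]

lemma measurableSet_badEnd (hA : A.PosDef) (i : ℕ) :
    MeasurableSet {ζ : ℕ → ℝ | BadEnd A θ σ T i ζ} := by
  by_cases hi : 1 ≤ i
  · have h := measurable_blockNorm_exploreObs (θ := θ) hA hi
    exact (measurableSet_endsAt hA i).inter
      ((measurableSet_lt h measurable_const).union (measurableSet_lt measurable_const h))
  · simp [BadEnd, EndsAt, hi]

lemma measurableSet_cycles (hA : A.PosDef) (i k : ℕ) :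
    MeasurableSet {ζ : ℕ → ℝ | EndsAt A θ σ T i ζ ∧ cycles A θ σ T i ζ = k} := by
  by_cases hi : 1 ≤ i
  · have h := measurable_blockNorm_exploreObs (θ := θ) hA hi
    have hc : Measurable fun ζ : ℕ → ℝ => cycles A θ σ T i ζ := by
      unfold cycles
      exact Nat.measurable_ceil.comp (measurable_const.div h)
    exact (measurableSet_endsAt hA i).inter (hc (measurableSet_singleton k))
  · simp [EndsAt, hi]

lemma measurableSet_goodEnd (hA : A.PosDef) (i k : ℕ) :
    MeasurableSet {ζ : ℕ → ℝ | GoodEnd A θ σ T i k ζ} := by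
  by_cases hi : 1 ≤ i
  · have h := measurable_blockNorm_exploreObs (θ := θ) hA hi
    have h2 := (measurableSet_cycles (θ := θ) (σ := σ) (T := T) hA i k).inter
      ((measurableSet_le (measurable_const (a := matNorm A θ / 2)) h).inter
        (measurableSet_le h (measurable_const (a := 33 / 20 * matNorm A θ))))
    convert h2 using 1
    ext ζ
    simp [GoodEnd, and_assoc]
  · simp [GoodEnd, EndsAt, hi]

variable {Ω : Type*} [MeasurableSpace Ω] {μ : Measure Ω} [IsProbabilityMeasure μ]
  {ζ : Ω → ℕ → ℝ}

omit [NeZero d] in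
lemma SubgaussianVec.integral_sq_le {v : ℝ} (hv : 0 < v) {X : Ω → Fin d → ℝ}
    (hX : SubgaussianVec μ v X) (hm : Measurable X) :
    Integrable (fun ω => ∑ j, X ω j ^ 2) μ ∧ ∫ ω, ∑ j, X ω j ^ 2 ∂μ ≤ d * v := by
  have h := hX.lintegral_sq_le hv hm
  rw [Fintype.card_fin] at h
  have h0 : 0 ≤ᵐ[μ] fun ω => ∑ j, X ω j ^ 2 :=
    Filter.Eventually.of_forall fun ω => Finset.sum_nonneg fun _ _ => sq_nonneg _
  have hmeas : Measurable fun ω => ∑ j, X ω j ^ 2 := by fun_prop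
  constructor
  · refine ⟨hmeas.aestronglyMeasurable, ?_⟩
    rw [hasFiniteIntegral_iff_ofReal h0]
    exact h.trans_lt ENNReal.ofReal_lt_top
  · rw [integral_eq_lintegral_of_nonneg_ae h0 hmeas.aestronglyMeasurable]
    exact ENNReal.toReal_le_of_le_ofReal (by positivity) h

omit [NeZero d] in
/-- The expected regret per round after committing on an estimate from `k` cycles. -/
lemma integral_commitRegret_le {xs : (Fin d → ℝ) → (Fin d → ℝ)} (hA : A.PosDef)
    (hxs : ∀ v, IsArgmax (ellipsoid 0 A) v (xs v)) {v : ℝ} (hv : 0 < v) {X : Ω → Fin d → ℝ}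
    (hX : SubgaussianVec μ v X) (hmeas : Measurable X) (hm : 0 < matNorm A θ) :
    ∫ ω, commitRegret A xs θ (CFC.sqrt A *ᵥ θ + X ω) ∂μ ≤ d * v / matNorm A θ +
      2 * matNorm A θ * Real.exp (min (2 * d / 3 - 11 / 30 * matNorm A θ ^ 2 / v) 0) := by
  set m := matNorm A θ with hmdef
  obtain ⟨h1, h2⟩ := hX.integral_sq_le hv hmeas
  have h3 := hX.norm_tail_le hv hmeas m
  rw [Fintype.card_fin] at h3
  set S : Set Ω := {ω | m ^ 2 ≤ ∑ j, X ω j ^ 2} with hS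
  have hSm : MeasurableSet S := measurableSet_le measurable_const (by fun_prop)
  have hi1 : Integrable (fun ω => (∑ j, X ω j ^ 2) / m) μ := h1.div_const m
  have hi2 : Integrable (S.indicator fun _ => 2 * m) μ := (integrable_const _).indicator hSm
  have hcr := commitRegret_mem hA hxs θ
  -- The quadratic bound applies when `‖X‖ < m`; on the complement `S` the trivial bound `2m` is
  -- used.
  calc ∫ ω, commitRegret A xs θ (CFC.sqrt A *ᵥ θ + X ω) ∂μ
      ≤ ∫ ω, ((∑ j, X ω j ^ 2) / m + S.indicator (fun _ => 2 * m) ω) ∂μ := by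
        refine integral_mono_of_nonneg (Filter.Eventually.of_forall fun ω => (hcr _).1)
          (hi1.add hi2) (Filter.Eventually.of_forall fun ω => ?_)
        have h0 : 0 ≤ (∑ j, X ω j ^ 2) / m :=
          div_nonneg (Finset.sum_nonneg fun _ _ => sq_nonneg _) hm.le
        by_cases hω : ω ∈ S
        · simp only [Set.indicator_of_mem hω]
          linarith [(hcr (CFC.sqrt A *ᵥ θ + X ω)).2]
        · simp only [Set.indicator_of_notMem hω, add_zero]
          exact commitRegret_le hA hxs hm (not_le.1 hω)
    _ = (∫ ω, ∑ j, X ω j ^ 2 ∂μ) / m + 2 * m * μ.real S := by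
        rw [integral_add hi1 hi2, integral_div, integral_indicator_const _ hSm, smul_eq_mul,
          mul_comm (μ.real S)]
    _ ≤ _ := by gcongr

omit [NeZero d] in
lemma blockLength_cast (i : ℕ) : ((blockLength d (i + 1) : ℕ) : ℝ) = d * 2 ^ i := by
  rw [blockLength, Nat.add_sub_cancel]
  push_cast
  rfl

lemma blockDelta_mem (hT : 0 < T) (i : ℕ) : 0 < blockDelta d T i ∧ blockDelta d T i ≤ 1 := by
  have hd : (0 : ℝ) < d := by exact_mod_cast Nat.pos_of_ne_zero (NeZero.ne d)
  refine ⟨lt_min ?_ one_pos, min_le_right _ _⟩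
  rw [blockLength]
  push_cast
  positivity

variable (hsub : ∀ a k : ℕ, k ≠ 0 →
  SubgaussianVec μ ((√2 * σ) ^ 2 / k) fun ω => avg d a k (ζ ω))

include hsub

/-- Warm-up ends after block `i + 1` with a bad estimate with small probability. -/
lemma measureReal_badEnd_le (hA : A.PosDef) (hmeas : Measurable ζ) (hσ : 0 < σ) (hT : 0 < T)
    (hm : 0 < matNorm A θ) {q : ℝ} (hqm : q * matNorm A θ ^ 2 = 2 * σ ^ 2 * (d : ℝ) ^ 2)
    (i : ℕ) :
    μ.real {ω | BadEnd A θ σ T (i + 1) (ζ ω)} ≤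
      d * (d * 2 ^ i) / (T / 2) * Real.exp (-(17 / 2000 * d / q * (d * 2 ^ i))) := by
  have hd : (0 : ℝ) < d := by exact_mod_cast Nat.pos_of_ne_zero (NeZero.ne d)
  have hq : 0 < q := by
    have h1 : 0 < q * matNorm A θ ^ 2 := by rw [hqm]; positivity
    exact pos_of_mul_pos_left h1 (by positivity)
  set m := matNorm A θ with hmdef
  -- Signal-to-noise ratio of the block: the squared radius without its logarithmic factor is `E = q
  -- m² / n`, so `m² = r E`, as `margin_of_bad` requires.
  set r : ℝ := d * 2 ^ i / q with hr
  have hr0 : 0 ≤ r := by positivity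
  set δ := blockDelta d (T / 2) (i + 1) with hδ
  obtain ⟨hδ0, hδ1⟩ := blockDelta_mem (d := d) (half_pos hT) (i + 1)
  have hX := hsub (blockEnd d i) (2 ^ i) (by positivity)
  have h := hX.confRadius_tail_le (s := √2 * σ) (δ := δ) (a := 17 / 2000 * r) (by positivity)
    (by positivity) ((measurable_avg _ _).comp hmeas) hδ0 hδ1 (by positivity) (margin_ge hr0)
  refine le_trans (measureReal_mono fun ω hω => ?_) (h.trans ?_)
  · obtain ⟨h1, h2⟩ := hω
    obtain ⟨h3, h4⟩ := blockNorm_exploreObs_bounds (θ := θ) hA h1.1 (ζ ω)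
    have h5 := h1.2.1
    rw [Passes, blockRadius, ← hδ, show blockLength d (i + 1) = d * 2 ^ i from rfl] at h5
    have h6 := margin_of_bad (E := (√2 * σ) ^ 2 * (d : ℝ) ^ 2 / (d * 2 ^ i : ℕ)) (r := r) hm
      h1.blockNorm_pos.le confRadius_nonneg h5 h3 h4 (le_confRadius_sq hδ0 hδ1) ?_ h2
    · rw [Real.sq_sqrt (Finset.sum_nonneg fun _ _ => sq_nonneg _)] at h6
      exact h6
    · rw [mul_pow, Real.sq_sqrt (by norm_num), ← hqm, hr]
      push_cast
      field_simp
  · refine mul_le_mul ((min_le_left _ _).trans (le_of_eq ?_)) (Real.exp_le_exp.2 (le_of_eq ?_))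
      (Real.exp_pos _).le (by positivity)
    · rw [blockLength_cast]
    · rw [hr]
      ring

/-- Warm-up goes on after block `i + 1` with small probability, once the confidence radius is at
most a quarter of the norm of the parameter. -/
lemma measureReal_noneEnds_le (hA : A.PosDef) (hmeas : Measurable ζ) (hσ : 0 < σ)
    (hm : 0 < matNorm A θ) {q : ℝ} (hqm : q * matNorm A θ ^ 2 = 2 * σ ^ 2 * (d : ℝ) ^ 2) {i : ℕ}
    (hU : blockRadius d σ T (i + 1) ≤ matNorm A θ / 4) :
    μ.real {ω | NoneEnds A θ σ T (i + 1) (ζ ω)} ≤ 16 * q / (d * 2 ^ i) := by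
  have hd : (0 : ℝ) < d := by exact_mod_cast Nat.pos_of_ne_zero (NeZero.ne d)
  set m := matNorm A θ with hmdef
  have hX := hsub (blockEnd d i) (2 ^ i) (by positivity)
  obtain ⟨h1, h2⟩ := hX.integral_sq_le (by positivity) ((measurable_avg _ _).comp hmeas)
  -- Not stopping means an estimate of norm at most `3U ≤ 3m/4`, hence an error of at least `m/4`;
  -- Markov's inequality is applied to the squared error.
  have h3 := mul_meas_ge_le_integral_of_nonneg (Filter.Eventually.of_forall fun ω =>
    Finset.sum_nonneg fun j _ => sq_nonneg (avg d (blockEnd d i) (2 ^ i) (ζ ω) j)) h1 (m ^ 2 / 16)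
  have h4 : μ.real {ω | NoneEnds A θ σ T (i + 1) (ζ ω)} ≤
      μ.real {ω | m ^ 2 / 16 ≤ ∑ j, avg d (blockEnd d i) (2 ^ i) (ζ ω) j ^ 2} := by
    refine measureReal_mono fun ω hω => ?_
    have h5 : ¬ Passes A θ σ T (i + 1) (ζ ω) := hω (i + 1) (by omega) le_rfl
    rw [Passes, not_lt] at h5
    have h6 := (blockNorm_exploreObs_bounds (θ := θ) hA (Nat.le_add_left 1 i) (ζ ω)).2
    have h7 : m / 4 ≤ √(∑ j, blockNoise d (i + 1) (ζ ω) j ^ 2) := by linarith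
    have h8 := (Real.le_sqrt' (by positivity)).1 h7
    have e : (m / 4) ^ 2 = m ^ 2 / 16 := by ring
    rw [e] at h8
    exact h8
  have h5 : m ^ 2 / 16 * μ.real {ω | NoneEnds A θ σ T (i + 1) (ζ ω)} ≤
      d * ((√2 * σ) ^ 2 / (2 ^ i : ℕ)) :=
    (mul_le_mul_of_nonneg_left h4 (by positivity)).trans (h3.trans h2)
  have e : d * ((√2 * σ) ^ 2 / (2 ^ i : ℕ)) = m ^ 2 / 16 * (16 * q / (d * 2 ^ i)) := by
    have e2 : m ^ 2 / 16 * (16 * q / (d * 2 ^ i)) = q * m ^ 2 / (d * 2 ^ i) := by ring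
    rw [e2, hqm, mul_pow, Real.sq_sqrt (by norm_num)]
    push_cast
    field_simp
  rw [e] at h5
  exact le_of_mul_le_mul_left h5 (by positivity)

/-- The expected cost of the warm-up. -/
lemma sum_warmup_le (hA : A.PosDef) (hmeas : Measurable ζ) (hσ : 0 < σ) {N : ℕ} (hN : 0 < N)
    (hm : 0 < matNorm A θ) {q : ℝ} (hqm : q * matNorm A θ ^ 2 = 2 * σ ^ 2 * (d : ℝ) ^ 2) :
    ∑ i ∈ Finset.range N, (if 2 * blockEnd d i < N then
        3 * matNorm A θ * (d * 2 ^ i) * μ.real {ω | NoneEnds A θ σ N i (ζ ω)} else 0) ≤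
      3 * d * matNorm A θ + 572 * (matNorm A θ * q * logBar (N / 2 / q)) := by
  have hd : (0 : ℝ) < d := by exact_mod_cast Nat.pos_of_ne_zero (NeZero.ne d)
  have hN' : (0 : ℝ) < N := by exact_mod_cast hN
  have hq : 0 < q := by
    have h1 : 0 < q * matNorm A θ ^ 2 := by rw [hqm]; positivity
    exact pos_of_mul_pos_left h1 (by positivity)
  set m := matNorm A θ with hmdef
  obtain ⟨M, rfl⟩ : ∃ M, N = M + 1 := ⟨N - 1, by omega⟩
  set T : ℝ := ((M + 1 : ℕ) : ℝ) with hT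
  set B := 36 * (q * logBar (T / 2 / q)) with hB
  have hΛ : 0 ≤ Real.log (max (T / 2 / q) 1) := Real.log_nonneg (le_max_right _ _)
  have hlog : 1 ≤ logBar (T / 2 / q) := by rw [logBar]; linarith
  -- The first block is split off: no test precedes it, so it is charged `3dm` outright.
  rw [Finset.sum_range_succ']
  have hzero : (if 2 * blockEnd d 0 < M + 1 then
      3 * m * (d * 2 ^ 0) * μ.real {ω | NoneEnds A θ σ T 0 (ζ ω)} else 0) ≤ 3 * d * m := by
    have h1 : μ.real {ω | NoneEnds A θ σ T 0 (ζ ω)} ≤ 1 := measureReal_le_one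
    have h2 : 0 ≤ 3 * m * (d * 2 ^ 0) := by positivity
    split_ifs
    · nlinarith
    · positivity
  -- The block played after block `i + 1` is twice as long, hence `6m`. Short blocks, `n ≤ B`, total
  -- at most `6m · 2B = 432 m q logBar`. A longer block costs at most `6m · 16q`, and by
  -- `card_doubling_le` these add at most `140 m q logBar`.
  have hterm : ∀ i ∈ Finset.range M, (if 2 * blockEnd d (i + 1) < M + 1 then
      3 * m * (d * 2 ^ (i + 1)) * μ.real {ω | NoneEnds A θ σ T (i + 1) (ζ ω)} else 0) ≤
      6 * m * (if (d : ℝ) * 2 ^ i ≤ B then (d : ℝ) * 2 ^ i else 0) +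
      96 * m * q * (if 16 * q ≤ d * 2 ^ i ∧ (d : ℝ) * 2 ^ i < T / 2 then 1 else 0) := by
    intro i _
    have hp1 : μ.real {ω | NoneEnds A θ σ T (i + 1) (ζ ω)} ≤ 1 := measureReal_le_one
    have hp0 : 0 ≤ μ.real {ω | NoneEnds A θ σ T (i + 1) (ζ ω)} := measureReal_nonneg
    set p := μ.real {ω | NoneEnds A θ σ T (i + 1) (ζ ω)}
    have hn : (0 : ℝ) < d * 2 ^ i := by positivity
    have h3 : 0 ≤ 96 * m * q * (if 16 * q ≤ d * 2 ^ i ∧ (d : ℝ) * 2 ^ i < T / 2 then 1 else 0) := by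
      split_ifs <;> positivity
    have h4 : 0 ≤ 6 * m * (if (d : ℝ) * 2 ^ i ≤ B then (d : ℝ) * 2 ^ i else 0) := by
      split_ifs <;> positivity
    by_cases hlt : 2 * blockEnd d (i + 1) < M + 1
    swap
    · rw [if_neg hlt]
      linarith
    rw [if_pos hlt]
    by_cases hle : (d : ℝ) * 2 ^ i ≤ B
    · rw [if_pos hle]
      have : 3 * m * (d * 2 ^ (i + 1)) * p ≤ 6 * m * (d * 2 ^ i) := by
        rw [pow_succ]
        nlinarith [mul_pos hm hn]
      linarith
    · rw [if_neg hle, mul_zero, zero_add]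
      have hU : blockRadius d σ T (i + 1) ≤ m / 4 := by
        by_contra hU
        push Not at hU
        refine hle ?_
        have := blockLength_le_of_lt_confRadius (d := d) (n := blockLength d (i + 1))
          (s := √2 * σ) (H := T / 2) (m := m) (q := q) ?_ hm hq (by positivity) ?_ hU
        · rwa [blockLength_cast] at this
        · rw [blockLength]
          have := NeZero.pos d
          positivity
        · rw [hqm, mul_pow, Real.sq_sqrt (by norm_num)]
      have h5 : 16 * q ≤ d * 2 ^ i := by nlinarith
      have h6 : (d : ℝ) * 2 ^ i < T / 2 := by
        have h7 : d * 2 ^ i ≤ blockEnd d (i + 1) := by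
          rw [blockEnd]
          refine Nat.mul_le_mul_left _ ?_
          have := Nat.one_le_two_pow (n := i)
          rw [pow_succ]
          omega
        have h8 : 2 * (d * 2 ^ i) < M + 1 := by omega
        have h9 : (2 * (d * 2 ^ i) : ℝ) < T := by rw [hT]; exact_mod_cast h8
        linarith
      rw [if_pos ⟨h5, h6⟩, mul_one]
      have h7 := measureReal_noneEnds_le hsub hA hmeas hσ hm hqm hU
      have h8 : d * 2 ^ i * p ≤ 16 * q := by
        rw [le_div_iff₀ hn] at h7
        linarith
      rw [pow_succ]
      nlinarith [mul_le_mul_of_nonneg_left h8 hm.le]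
  have hsum := Finset.sum_le_sum hterm
  rw [Finset.sum_add_distrib, ← Finset.mul_sum, ← Finset.mul_sum,
    ← Finset.sum_filter (fun i => (d : ℝ) * 2 ^ i ≤ B), Finset.sum_boole] at hsum
  have h1 := sum_doubling_filter_le (x := d) (B := B) hd.le (by positivity) M
  have h2 := card_doubling_le (x := d) (q := q) (H := T / 2) hq M
  have h3 : 6 * m * ∑ i ∈ Finset.range M with (d : ℝ) * 2 ^ i ≤ B, (d : ℝ) * 2 ^ i ≤
      6 * m * (2 * B) := mul_le_mul_of_nonneg_left h1 (by positivity)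
  have h4 := mul_le_mul_of_nonneg_left h2 (show 0 ≤ 96 * m * q by positivity)
  have e : Real.log (max (T / 2 / q) 1) = logBar (T / 2 / q) - 1 := by rw [logBar]; ring
  have h6 : 6 * m * (2 * B) = 432 * (m * q * logBar (T / 2 / q)) := by rw [hB]; ring
  have h5 : 0 ≤ m * q := by positivity
  have h7 : 96 * m * q * (29 / 20 * Real.log (max (T / 2 / q) 1)) ≤
      140 * (m * q * logBar (T / 2 / q)) := by
    rw [e]
    nlinarith [mul_nonneg h5 (show 0 ≤ logBar (T / 2 / q) by linarith)]
  refine (add_le_add (hsum.trans (add_le_add (h3.trans h6.le) (h4.trans h7))) hzero).trans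
    (le_of_eq ?_)
  ring

/-- The expected cost of a bad end of the warm-up. -/
lemma sum_badEnd_le (hA : A.PosDef) (hmeas : Measurable ζ) (hσ : 0 < σ) {N : ℕ} (hN : 0 < N)
    (hm : 0 < matNorm A θ) {q : ℝ} (hqm : q * matNorm A θ ^ 2 = 2 * σ ^ 2 * (d : ℝ) ^ 2) :
    ∑ i ∈ Finset.Icc 1 N, 2 * matNorm A θ * N * μ.real {ω | BadEnd A θ σ N i (ζ ω)} ≤
      706 * (matNorm A θ * q) := by
  have hd : (0 : ℝ) < d := by exact_mod_cast Nat.pos_of_ne_zero (NeZero.ne d)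
  have hN' : (0 : ℝ) < N := by exact_mod_cast hN
  have hq : 0 < q := by
    have h1 : 0 < q * matNorm A θ ^ 2 := by rw [hqm]; positivity
    exact pos_of_mul_pos_left h1 (by positivity)
  set m := matNorm A θ with hmdef
  set x : ℝ := 17 / 2000 * d / q * d with hx
  have hx0 : 0 < x := by positivity
  rw [← Finset.Ico_add_one_right_eq_Icc, Finset.sum_Ico_eq_sum_range, Nat.add_sub_cancel]
  have hterm : ∀ i ∈ Finset.range N,
      2 * m * N * μ.real {ω | BadEnd A θ σ N (1 + i) (ζ ω)} ≤
        4 * m * q * (2000 / 17) * (x * 2 ^ i * Real.exp (-(x * 2 ^ i))) := by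
    intro i _
    rw [add_comm 1 i]
    have h := measureReal_badEnd_le hsub hA hmeas hσ hN' hm hqm i
    have h1 := mul_le_mul_of_nonneg_left h (show 0 ≤ 2 * m * N by positivity)
    refine h1.trans (le_of_eq ?_)
    have e : 17 / 2000 * d / q * (d * 2 ^ i) = x * 2 ^ i := by rw [hx]; ring
    rw [e]
    -- Here `N` cancels, which is the purpose of taking `δ_i` proportional to `n_i / H`. Summation
    -- then gives `4 · (2000/17) · (3/2) < 706`.
    have e2 : 2 * m * N * (d * (d * 2 ^ i) / (N / 2)) = 4 * m * q * (2000 / 17) * (x * 2 ^ i) := by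
      rw [hx]
      field_simp
      ring
    rw [← mul_assoc, e2]
    ring
  refine (Finset.sum_le_sum hterm).trans ?_
  rw [← Finset.mul_sum]
  have h := mul_le_mul_of_nonneg_left (sum_doubling_mul_exp_le hx0.le N)
    (show 0 ≤ 4 * m * q * (2000 / 17) by positivity)
  refine h.trans ?_
  nlinarith [mul_pos hm hq]

end Outcomes

/-! ### The expected regret -/

section Expectation

variable {d : ℕ} [NeZero d] {A : Matrix (Fin d) (Fin d) ℝ} {xs : (Fin d → ℝ) → (Fin d → ℝ)}
  {c θ xopt : Fin d → ℝ} {σ T : ℝ}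

lemma regret_mem (hA : A.PosDef) (hxs : ∀ v, IsArgmax (ellipsoid 0 A) v (xs v))
    (hxopt : IsArgmax (ellipsoid c A) θ xopt) (hσ : 0 < σ) (hT : 0 < T) (z : ℕ → ℝ) (t : ℕ) :
    xopt ⬝ᵥ θ - action (translatedE2TC c A xs 3 σ T) θ z t ⬝ᵥ θ ∈
      Set.Icc 0 (2 * matNorm A θ) := by
  by_cases h : ∃ i, EndsAt A θ σ T i (pairDiff z) ∧
      blockEnd d i + d * cycles A θ σ T i (pairDiff z) ≤ t / 2
  · obtain ⟨i, h1, h2⟩ := h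
    rw [regret_commit hA hxopt hσ hT h1 h2]
    exact commitRegret_mem hA hxs θ _
  · push Not at h
    rw [regret_explore hA hxopt h]
    have h1 := exploreRegret_mem (θ := θ) hA t
    exact ⟨h1.1, h1.2.trans (exploreCost_le (matNorm_nonneg A θ) t)⟩

/-- The regret of a round is a measurable function of the noise. -/
lemma measurable_regret (hA : A.PosDef) (hxs : ∀ v, IsArgmax (ellipsoid 0 A) v (xs v))
    (hxopt : IsArgmax (ellipsoid c A) θ xopt) (hσ : 0 < σ) (hT : 0 < T) (t : ℕ) :
    Measurable fun z : ℕ → ℝ =>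
      xopt ⬝ᵥ θ - action (translatedE2TC c A xs 3 σ T) θ z t ⬝ᵥ θ := by
  -- A commitment made by round `t` has `i, k ≤ t`, because `i ≤ blockEnd d i` and `k ≤ d k`. The
  -- regret is therefore a finite sum of measurable pieces.
  set S : ℕ × ℕ → Set (ℕ → ℝ) := fun p =>
    {ζ | EndsAt A θ σ T p.1 ζ ∧ cycles A θ σ T p.1 ζ = p.2} with hS
  set I := (Finset.Icc 1 t ×ˢ Finset.Icc 1 t).filter fun p => blockEnd d p.1 + d * p.2 ≤ t / 2
    with hI
  set G : ℕ × ℕ → (ℕ → ℝ) → ℝ := fun p ζ =>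
    commitRegret A xs θ (CFC.sqrt A *ᵥ θ + avg d (blockEnd d p.1) p.2 ζ) - exploreRegret A θ t
    with hG
  have key : (fun z : ℕ → ℝ => xopt ⬝ᵥ θ - action (translatedE2TC c A xs 3 σ T) θ z t ⬝ᵥ θ) =
      fun z => exploreRegret A θ t + ∑ p ∈ I, (S p).indicator (G p) (pairDiff z) := by
    funext z
    by_cases h : ∃ i, EndsAt A θ σ T i (pairDiff z) ∧
        blockEnd d i + d * cycles A θ σ T i (pairDiff z) ≤ t / 2
    · obtain ⟨i, h1, h2⟩ := h
      set k := cycles A θ σ T i (pairDiff z) with hk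
      have hk0 : k ≠ 0 := h1.cycles_ne_zero hσ hT
      have hmem : (i, k) ∈ I := by
        rw [hI, Finset.mem_filter, Finset.mem_product, Finset.mem_Icc, Finset.mem_Icc]
        have h3 := le_blockEnd (d := d) i
        have h4 : 1 * k ≤ d * k := Nat.mul_le_mul_right _ NeZero.one_le
        have h5 := h1.1
        refine ⟨⟨⟨h5, ?_⟩, ?_, ?_⟩, h2⟩ <;> simp only <;> omega
      rw [Finset.sum_eq_single_of_mem _ hmem, Set.indicator_of_mem (show pairDiff z ∈ S (i, k) from
        ⟨h1, rfl⟩), regret_commit hA hxopt hσ hT h1 h2]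
      · simp only [hG]
        ring
      · rintro ⟨j, l⟩ _ hne
        refine Set.indicator_of_notMem ?_ _
        rintro ⟨h3, h4⟩
        simp only at h3 h4
        obtain rfl := h3.unique h1
        exact hne (by rw [hk, h4])
    · rw [Finset.sum_eq_zero, add_zero]
      · push Not at h
        exact regret_explore hA hxopt h
      · intro p hp
        refine Set.indicator_of_notMem ?_ _
        rintro ⟨h3, h4⟩
        exact h ⟨p.1, h3, by rw [h4]; exact (Finset.mem_filter.1 hp).2⟩
  rw [key]
  refine measurable_const.add (Finset.measurable_fun_sum _ fun p _ => ?_)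
  refine Measurable.comp (Measurable.indicator ?_ (measurableSet_cycles hA p.1 p.2))
    measurable_pairDiff
  exact ((measurable_commitRegret hA hxs θ).comp
    (measurable_const.add (measurable_avg _ _))).sub measurable_const

variable {Ω : Type*} [MeasurableSpace Ω] {μ : Measure Ω} [IsProbabilityMeasure μ]
  {ζ : Ω → ℕ → ℝ}

lemma pathRegret_mem (hA : A.PosDef) (hxs : ∀ v, IsArgmax (ellipsoid 0 A) v (xs v))
    (hxopt : IsArgmax (ellipsoid c A) θ xopt) (hσ : 0 < σ) {N : ℕ} (hN : 0 < N) (z : ℕ → ℝ) :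
    pathRegret (translatedE2TC c A xs 3 σ N) θ xopt N z ∈
      Set.Icc 0 (N * (2 * matNorm A θ)) := by
  have h := regret_mem hA hxs hxopt hσ (show (0 : ℝ) < N by exact_mod_cast hN) z
  refine ⟨Finset.sum_nonneg fun t _ => (h t).1, ?_⟩
  refine (Finset.sum_le_sum fun t _ => (h t).2).trans (le_of_eq ?_)
  rw [Finset.sum_const, Finset.card_range, nsmul_eq_mul]

lemma integrable_pathRegret (hA : A.PosDef) (hxs : ∀ v, IsArgmax (ellipsoid 0 A) v (xs v))
    (hxopt : IsArgmax (ellipsoid c A) θ xopt) (hσ : 0 < σ) {N : ℕ} (hN : 0 < N)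
    {z : ℕ → Ω → ℝ} (hz_meas : ∀ t, Measurable (z t)) :
    Integrable (fun ω => pathRegret (translatedE2TC c A xs 3 σ N) θ xopt N fun t => z t ω) μ := by
  refine Integrable.of_mem_Icc 0 (N * (2 * matNorm A θ)) ?_
    (Filter.Eventually.of_forall fun ω => pathRegret_mem hA hxs hxopt hσ hN _)
  have h1 : Measurable fun ω t => z t ω := measurable_pi_lambda _ hz_meas
  unfold pathRegret
  exact (Finset.measurable_fun_sum _ fun t _ => (measurable_regret hA hxs hxopt hσ
    (show (0 : ℝ) < N by exact_mod_cast hN) t).comp h1).aemeasurable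

lemma integral_ite_const (hmeas : Measurable ζ) {p : (ℕ → ℝ) → Prop} [DecidablePred p]
    (hp : MeasurableSet {x | p x}) (a : ℝ) :
    Integrable (fun ω => if p (ζ ω) then a else 0) μ ∧
      ∫ ω, (if p (ζ ω) then a else 0) ∂μ = a * μ.real {ω | p (ζ ω)} := by
  have hS : MeasurableSet {ω | p (ζ ω)} := hmeas hp
  have e : (fun ω => if p (ζ ω) then a else 0) = {ω | p (ζ ω)}.indicator fun _ => a := by
    funext ω
    simp [Set.indicator_apply]
  rw [e, integral_indicator_const _ hS, smul_eq_mul, mul_comm]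
  exact ⟨(integrable_const _).indicator hS, rfl⟩

open Classical in
/-- The estimate of the second exploration phase is independent of the warm-up. -/
lemma integral_goodEnd_eq (hA : A.PosDef) (hxs : ∀ v, IsArgmax (ellipsoid 0 A) v (xs v))
    (hmeas : Measurable ζ)
    (hind : ∀ a k : ℕ, IndepFun (fun ω => past a (ζ ω)) (fun ω => avg d a k (ζ ω)) μ)
    (i k : ℕ) (a b : ℝ) :
    Integrable (fun ω => if GoodEnd A θ σ T i k (ζ ω) then
        a + b * commitRegret A xs θ (CFC.sqrt A *ᵥ θ + avg d (blockEnd d i) k (ζ ω)) else 0) μ ∧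
      ∫ ω, (if GoodEnd A θ σ T i k (ζ ω) then
        a + b * commitRegret A xs θ (CFC.sqrt A *ᵥ θ + avg d (blockEnd d i) k (ζ ω)) else 0) ∂μ =
      μ.real {ω | GoodEnd A θ σ T i k (ζ ω)} * (a + b *
        ∫ ω, commitRegret A xs θ (CFC.sqrt A *ᵥ θ + avg d (blockEnd d i) k (ζ ω)) ∂μ) := by
  have hGm := measurableSet_goodEnd (θ := θ) (σ := σ) (T := T) hA i k
  set φ : (ℕ → ℝ) → ℝ := {x | GoodEnd A θ σ T i k x}.indicator fun _ => 1 with hφ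
  set ψ : (Fin d → ℝ) → ℝ := fun v => a + b * commitRegret A xs θ (CFC.sqrt A *ᵥ θ + v) with hψ
  have hφm : Measurable φ := measurable_const.indicator hGm
  have hcm : Measurable fun v => commitRegret A xs θ (CFC.sqrt A *ᵥ θ + v) :=
    (measurable_commitRegret hA hxs θ).comp (measurable_const.add measurable_id)
  have hψm : Measurable ψ := measurable_const.add (hcm.const_mul b)
  have hU : Measurable fun ω => past (blockEnd d i) (ζ ω) := (measurable_past _).comp hmeas
  have hV : Measurable fun ω => avg d (blockEnd d i) k (ζ ω) := (measurable_avg _ _).comp hmeas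
  have e : (fun ω => if GoodEnd A θ σ T i k (ζ ω) then
      a + b * commitRegret A xs θ (CFC.sqrt A *ᵥ θ + avg d (blockEnd d i) k (ζ ω)) else 0) =
      fun ω => φ (past (blockEnd d i) (ζ ω)) * ψ (avg d (blockEnd d i) k (ζ ω)) := by
    funext ω
    simp only [hφ, hψ, Set.indicator_apply, Set.mem_ofPred_eq, goodEnd_past hA]
    split_ifs <;> simp
  have hφi : Integrable (fun ω => φ (past (blockEnd d i) (ζ ω))) μ := by
    refine Integrable.of_mem_Icc 0 1 (hφm.comp hU).aemeasurable
      (Filter.Eventually.of_forall fun ω => ?_)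
    simp only [hφ, Set.indicator_apply]
    split_ifs <;> simp
  have hci : Integrable (fun ω =>
      commitRegret A xs θ (CFC.sqrt A *ᵥ θ + avg d (blockEnd d i) k (ζ ω))) μ :=
    Integrable.of_mem_Icc 0 (2 * matNorm A θ) (hcm.comp hV).aemeasurable
      (Filter.Eventually.of_forall fun ω => commitRegret_mem hA hxs θ _)
  have hψi : Integrable (fun ω => ψ (avg d (blockEnd d i) k (ζ ω))) μ :=
    (integrable_const a).add (hci.const_mul b)
  have hI := (hind (blockEnd d i) k).comp hφm hψm
  rw [e]
  refine ⟨hI.integrable_mul hφi hψi, ?_⟩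
  have h1 := hI.integral_fun_mul_eq_mul_integral hφi.aestronglyMeasurable hψi.aestronglyMeasurable
  simp only [Function.comp] at h1
  rw [h1]
  congr 1
  · have e2 : (fun ω => φ (past (blockEnd d i) (ζ ω))) =
        {ω | GoodEnd A θ σ T i k (ζ ω)}.indicator fun _ => 1 := by
      funext ω
      simp only [hφ, Set.indicator_apply, Set.mem_ofPred_eq, goodEnd_past hA]
    have hGm' : MeasurableSet {ω | GoodEnd A θ σ T i k (ζ ω)} := hmeas hGm
    rw [e2, integral_indicator_const _ hGm', smul_eq_mul, mul_one]
  · simp only [hψ]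
    rw [integral_add (integrable_const a) (hci.const_mul b), integral_const_mul]
    simp

/-- The total cost after a good end of the warm-up. -/
lemma exploreCommit_cost_le {m B v : ℝ} {k N : ℕ} (hσ : 0 < σ) (hN : 0 < N) (hm : 0 < m)
    (hB : 0 < B) (hB1 : m / 2 ≤ B) (hB2 : B ≤ 33 / 20 * m) (hk : k = ⌈σ * √N / B⌉₊)
    (hv : v = 2 * σ ^ 2 / k) :
    3 * m * (d * k : ℕ) + N * (d * v / m +
        2 * m * Real.exp (min (2 * d / 3 - 11 / 30 * m ^ 2 / v) 0)) ≤
      7 * d * σ * √N + 3 * d * m +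
        2 * N * m * Real.exp (min (2 * d / 3 - 1 / 9 * √N * m / σ) 0) := by
  have hd : (0 : ℝ) < d := by exact_mod_cast Nat.pos_of_ne_zero (NeZero.ne d)
  have hN' : (0 : ℝ) < N := by exact_mod_cast hN
  set x := √(N : ℝ) with hx
  have hx0 : 0 < x := Real.sqrt_pos.2 hN'
  have hx2 : x ^ 2 = N := Real.sq_sqrt hN'.le
  have hk1 : σ * x / B ≤ k := by rw [hk]; exact Nat.le_ceil _
  have hk2 : (k : ℝ) < σ * x / B + 1 := by rw [hk]; exact Nat.ceil_lt_add_one (by positivity)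
  have hk0 : (0 : ℝ) < k := lt_of_lt_of_le (by positivity) hk1
  have hkB : σ * x ≤ k * B := by rwa [div_le_iff₀ hB] at hk1
  have h1 : N * (d * v / m) ≤ d * (σ * x) * (2 * B / m) := by
    rw [hv, ← hx2]
    have e1 : x ^ 2 * (d * (2 * σ ^ 2 / k) / m) = (d * (σ * x) * 2 / m) * (σ * x / k) := by
      field_simp
    have e2 : d * (σ * x) * (2 * B / m) = (d * (σ * x) * 2 / m) * B := by ring
    rw [e1, e2]
    gcongr
    rw [div_le_iff₀ hk0]
    linarith
  have h2 : 3 * m * (d * k : ℕ) ≤ d * (σ * x) * (3 * m / B) + 3 * d * m := by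
    push_cast
    have e1 : d * (σ * x) * (3 * m / B) + 3 * d * m = 3 * m * (d * (σ * x / B + 1)) := by ring
    rw [e1]
    gcongr
  -- Equivalent to `(2B - m)(3m - B) ≥ 0`; equality at `B = m/2` is the source of the constant `7`.
  have h3 : 3 * m / B + 2 * B / m ≤ 7 := by
    rw [div_add_div _ _ hB.ne' hm.ne', div_le_iff₀ (by positivity)]
    nlinarith [mul_nonneg (sub_nonneg.2 hB1) (show 0 ≤ 3 * m - B by linarith)]
  have h4 : d * (σ * x) * (3 * m / B) + d * (σ * x) * (2 * B / m) ≤ 7 * d * σ * x := by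
    rw [← mul_add]
    refine (mul_le_mul_of_nonneg_left h3 (by positivity)).trans (le_of_eq ?_)
    ring
  have h5 : 1 / 9 * x * m / σ ≤ 11 / 30 * m ^ 2 / v := by
    have e1 : 11 / 30 * m ^ 2 / v = 11 / 60 * m ^ 2 * k / σ ^ 2 := by
      rw [hv]
      field_simp
      norm_num
    rw [e1, div_le_div_iff₀ hσ (by positivity)]
    have h6 : σ * x ≤ k * (33 / 20 * m) :=
      hkB.trans (mul_le_mul_of_nonneg_left hB2 hk0.le)
    have h7 := mul_le_mul_of_nonneg_left h6 (show 0 ≤ 1 / 9 * m * σ by positivity)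
    nlinarith
  have h6 : Real.exp (min (2 * d / 3 - 11 / 30 * m ^ 2 / v) 0) ≤
      Real.exp (min (2 * d / 3 - 1 / 9 * x * m / σ) 0) := by
    gcongr
  have h7 := mul_le_mul_of_nonneg_left h6 (show 0 ≤ 2 * N * m by positivity)
  rw [mul_add]
  linarith

open Classical in
/-- The expected cost of exploration and commitment after a good end of the warm-up. -/
lemma sum_goodEnd_le (hA : A.PosDef) (hxs : ∀ v, IsArgmax (ellipsoid 0 A) v (xs v))
    (hmeas : Measurable ζ)
    (hind : ∀ a k : ℕ, IndepFun (fun ω => past a (ζ ω)) (fun ω => avg d a k (ζ ω)) μ)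
    (hsub : ∀ a k : ℕ, k ≠ 0 → SubgaussianVec μ ((√2 * σ) ^ 2 / k) fun ω => avg d a k (ζ ω))
    (hσ : 0 < σ) {N : ℕ} (hN : 0 < N) (hm : 0 < matNorm A θ) (K : ℕ) :
    ∑ i ∈ Finset.Icc 1 N, ∑ k ∈ Finset.Icc 1 K, ∫ ω, (if GoodEnd A θ σ N i k (ζ ω) then
        3 * matNorm A θ * (d * k : ℕ) + N * commitRegret A xs θ
          (CFC.sqrt A *ᵥ θ + avg d (blockEnd d i) k (ζ ω)) else 0) ∂μ ≤
      7 * d * σ * √N + 3 * d * matNorm A θ + 2 * N * matNorm A θ *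
        Real.exp (min (2 * d / 3 - 1 / 9 * √N * matNorm A θ / σ) 0) := by
  set m := matNorm A θ with hmdef
  set C := 7 * d * σ * √N + 3 * d * m + 2 * N * m *
    Real.exp (min (2 * d / 3 - 1 / 9 * √N * m / σ) 0) with hC
  have hC0 : 0 ≤ C := by positivity
  set G : ℕ × ℕ → Set Ω := fun p => {ω | GoodEnd A θ σ N p.1 p.2 (ζ ω)} with hG
  have hcell : ∀ i ∈ Finset.Icc 1 N, ∀ k ∈ Finset.Icc 1 K,
      ∫ ω, (if GoodEnd A θ σ N i k (ζ ω) then 3 * m * (d * k : ℕ) + N * commitRegret A xs θ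
        (CFC.sqrt A *ᵥ θ + avg d (blockEnd d i) k (ζ ω)) else 0) ∂μ ≤ μ.real (G (i, k)) * C := by
    intro i _ k hk
    rw [(integral_goodEnd_eq hA hxs hmeas hind i k _ _).2]
    -- A sample point of the cell certifies `k = ⌈σ√N/B⌉` for some admissible `B`, which is all that
    -- the deterministic cost bound needs; an empty cell contributes nothing.
    rcases (G (i, k)).eq_empty_or_nonempty with hemp | ⟨ω, hω⟩
    · have h0 : μ.real {ω | GoodEnd A θ σ N i k (ζ ω)} = 0 := by
        change μ.real (G (i, k)) = 0
        rw [hemp, measureReal_empty]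
      rw [h0, zero_mul]
      positivity
    · refine mul_le_mul_of_nonneg_left ?_ measureReal_nonneg
      have hk0 : k ≠ 0 := by have := (Finset.mem_Icc.1 hk).1; omega
      have hk' : (0 : ℝ) < k := by exact_mod_cast Nat.pos_of_ne_zero hk0
      have hv : (√2 * σ) ^ 2 / (k : ℝ) = 2 * σ ^ 2 / k := by
        rw [mul_pow, Real.sq_sqrt (by norm_num)]
      have h1 := integral_commitRegret_le hA hxs (v := (√2 * σ) ^ 2 / k) (by positivity)
        (hsub (blockEnd d i) k hk0) ((measurable_avg _ _).comp hmeas) hm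
      obtain ⟨h2, h3, h4, h5⟩ := hω
      simp only at h2 h3 h4 h5
      have h6 := exploreCommit_cost_le (d := d) (k := k) hσ hN hm h2.blockNorm_pos h4 h5
        (by rw [← h3, cycles, sqrt_two_mul_sqrt]) hv
      refine le_trans ?_ h6
      gcongr
  have hdisj : Set.PairwiseDisjoint (↑(Finset.Icc 1 N ×ˢ Finset.Icc 1 K)) G := by
    rintro ⟨i, k⟩ _ ⟨j, l⟩ _ hne
    refine Set.disjoint_left.2 fun ω h1 h2 => hne ?_
    obtain ⟨h3, h4, _⟩ := h1
    obtain ⟨h5, h6, _⟩ := h2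
    simp only at h3 h4 h5 h6
    obtain rfl := h3.unique h5
    rw [← h4, ← h6]
  have hsum : ∑ p ∈ Finset.Icc 1 N ×ˢ Finset.Icc 1 K, μ.real (G p) ≤ 1 := by
    rw [← measureReal_biUnion_finset hdisj fun p _ => hmeas (measurableSet_goodEnd hA p.1 p.2)]
    exact measureReal_le_one
  calc _ ≤ ∑ i ∈ Finset.Icc 1 N, ∑ k ∈ Finset.Icc 1 K, μ.real (G (i, k)) * C :=
        Finset.sum_le_sum fun i hi => Finset.sum_le_sum fun k hk => hcell i hi k hk
    _ = (∑ p ∈ Finset.Icc 1 N ×ˢ Finset.Icc 1 K, μ.real (G p)) * C := by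
        rw [Finset.sum_product, Finset.sum_mul]
        exact Finset.sum_congr rfl fun i _ => (Finset.sum_mul _ _ _).symm
    _ ≤ C := mul_le_of_le_one_left hC0 hsum

end Expectation

/-- The regret bound; centredness of the noise is implied by the subgaussian condition. -/
lemma integral_pathRegret_le {d : ℕ} [NeZero d] {Ω : Type*} [MeasurableSpace Ω]
    (μ : Measure Ω) [IsProbabilityMeasure μ]
    (A : Matrix (Fin d) (Fin d) ℝ) (hA : A.PosDef) (c : Fin d → ℝ)
    (σ : ℝ≥0) (hσ : 0 < σ)
    (z : ℕ → Ω → ℝ) (hz_meas : ∀ t, Measurable (z t)) (hz_indep : iIndepFun z μ)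
    (hz_subG : ∀ t, HasSubgaussianMGF (z t) (σ ^ 2) μ)
    (xs : (Fin d → ℝ) → (Fin d → ℝ))
    (hxs : ∀ v, IsArgmax (ellipsoid 0 A) v (xs v))
    (θ xopt : Fin d → ℝ)
    (hxopt : IsArgmax (ellipsoid c A) θ xopt)
    (T : ℕ) :
    Integrable (fun ω => pathRegret
        (translatedE2TC c A xs 3 σ T) θ xopt T (fun t => z t ω)) μ ∧
    ∫ ω, pathRegret
        (translatedE2TC c A xs 3 σ T) θ xopt T (fun t => z t ω) ∂μ ≤
      7 * d * σ * Real.sqrt T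
      + 2622 * (σ : ℝ) ^ 2 * (d : ℝ) ^ 2 / matNorm A θ
          * logBar
              (T * matNorm A θ ^ 2 / (4 * (σ : ℝ) ^ 2 * (d : ℝ) ^ 2))
      + 2 * T * matNorm A θ
          * Real.exp
              (min (2 * d / 3 - 1 / 9 * Real.sqrt T * matNorm A θ / σ) 0)
      + 392 * d * matNorm A θ := by
  classical
  have hlog : ∀ x, 1 ≤ logBar x := fun x => by
    have := Real.log_nonneg (le_max_right x 1)
    rw [logBar]
    linarith
  have hσ' : (0 : ℝ) < σ := by exact_mod_cast hσ
  have hm0 := matNorm_nonneg A θ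
  set m := matNorm A θ with hm
  set L := logBar (T * m ^ 2 / (4 * (σ : ℝ) ^ 2 * (d : ℝ) ^ 2)) with hL
  have hL1 : 1 ≤ L := hlog _
  have hd : (0 : ℝ) < d := by exact_mod_cast Nat.pos_of_ne_zero (NeZero.ne d)
  rcases Nat.eq_zero_or_pos T with hT | hT
  · have e : (fun ω => pathRegret (translatedE2TC c A xs 3 σ T) θ xopt T (fun t => z t ω)) =
        fun _ => 0 := by
      funext ω
      simp [pathRegret, hT]
    rw [e]
    refine ⟨integrable_const _, ?_⟩
    rw [integral_zero]
    positivity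
  refine ⟨integrable_pathRegret hA hxs hxopt hσ' hT hz_meas, ?_⟩
  -- For `‖θ‖_A = 0` every round has zero regret, and division by zero makes the logarithmic term
  -- vanish.
  rcases hm0.eq_or_lt with h0 | hmpos
  · have h := fun ω => pathRegret_mem hA hxs hxopt hσ' hT fun t => z t ω
    rw [← hm, ← h0, mul_zero, mul_zero] at h
    simp_rw [fun ω => le_antisymm (h ω).2 (h ω).1]
    rw [integral_zero]
    positivity
  set ζ : Ω → ℕ → ℝ := fun ω => pairDiff fun t => z t ω with hζ
  have hmeas : Measurable ζ := measurable_pairDiff.comp (measurable_pi_lambda _ hz_meas)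
  have hind := fun a k : ℕ => indepFun_past_avg (d := d) hz_meas hz_indep a k
  have hsub : ∀ a k : ℕ, k ≠ 0 →
      SubgaussianVec μ ((√2 * σ) ^ 2 / k) fun ω => avg d a k (ζ ω) := by
    intro a k hk
    have := subgaussianVec_avg (d := d) hz_indep hz_subG a hk
    rwa [NNReal.coe_pow, show 2 * (σ : ℝ) ^ 2 = (√2 * σ) ^ 2 by
      rw [mul_pow, Real.sq_sqrt (by norm_num)]] at this
  set q := 2 * (σ : ℝ) ^ 2 * (d : ℝ) ^ 2 / m ^ 2 with hq
  have hqm : q * m ^ 2 = 2 * (σ : ℝ) ^ 2 * (d : ℝ) ^ 2 := by rw [hq]; field_simp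
  set K := ⌈2 * (σ * √(T : ℝ)) / m⌉₊ with hK
  have hpath := fun ω => pathRegret_le (z := fun t => z t ω) hA hxs hxopt hσ' hT hmpos
    (Nat.le_ceil (2 * (σ * √(T : ℝ)) / m))
  have hw := fun i => integral_ite_const (μ := μ) hmeas
    (p := fun x => 2 * blockEnd d i < T ∧ NoneEnds A θ σ T i x)
    ((MeasurableSet.const (2 * blockEnd d i < T)).inter (measurableSet_noneEnds hA i))
    (3 * m * (d * 2 ^ i))
  have hb := fun i => integral_ite_const (μ := μ) hmeas
    (measurableSet_badEnd (θ := θ) (σ := σ) (T := T) hA i) (2 * m * T)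
  have hg := fun i k => integral_goodEnd_eq (θ := θ) (σ := σ) (T := T) hA hxs hmeas hind i k
    (3 * m * (d * k : ℕ)) T
  have hw' := integrable_finsetSum (Finset.range T) fun i _ => (hw i).1
  have hg' := fun i => integrable_finsetSum (Finset.Icc 1 K) fun k _ => (hg i k).1
  have hbg' := integrable_finsetSum (Finset.Icc 1 T) fun i _ => (hb i).1.fun_add (hg' i)
  refine (integral_mono (integrable_pathRegret hA hxs hxopt hσ' hT hz_meas) (hw'.fun_add hbg')
    hpath).trans ?_
  rw [integral_add hw' hbg', integral_finsetSum _ fun i _ => (hw i).1,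
    integral_finsetSum _ fun i _ => (hb i).1.fun_add (hg' i)]
  rw [Finset.sum_congr rfl fun i _ => integral_add (hb i).1 (hg' i), Finset.sum_add_distrib,
    Finset.sum_congr rfl fun i _ => (hb i).2, Finset.sum_congr rfl fun i _ => (hw i).2,
    Finset.sum_congr rfl fun i _ => integral_finsetSum _ fun k _ => (hg i k).1]
  have h1 := sum_warmup_le hsub hA hmeas hσ' hT hmpos hqm
  have h2 := sum_badEnd_le hsub hA hmeas hσ' hT hmpos hqm
  have h3 := sum_goodEnd_le hA hxs hmeas hind hsub hσ' hT hmpos K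
  have h4 : ∑ i ∈ Finset.range T, 3 * m * (d * 2 ^ i) *
      μ.real {ω | 2 * blockEnd d i < T ∧ NoneEnds A θ σ T i (ζ ω)} ≤
      ∑ i ∈ Finset.range T, (if 2 * blockEnd d i < T then
        3 * m * (d * 2 ^ i) * μ.real {ω | NoneEnds A θ σ T i (ζ ω)} else 0) := by
    refine Finset.sum_le_sum fun i _ => ?_
    split_ifs with h <;> simp [h]
  have e1 : (T : ℝ) / 2 / q = T * m ^ 2 / (4 * (σ : ℝ) ^ 2 * (d : ℝ) ^ 2) := by
    rw [hq]
    field_simp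
    norm_num
  rw [e1, ← hL, ← hm] at h1
  rw [← hm] at h2 h3
  -- In units of `m q L` the three parts need `572 + 706 = 1278 ≤ 1311`, and in units of `d m` they
  -- need `3 + 3 ≤ 392`.
  have e2 : 2622 * (σ : ℝ) ^ 2 * (d : ℝ) ^ 2 / m * L = 1311 * (m * q * L) := by
    rw [hq]
    field_simp
    norm_num
  have h5 : m * q ≤ m * q * L := le_mul_of_one_le_right (by positivity) hL1
  have h6 : 0 ≤ d * m := by positivity
  have h7 : 0 ≤ m * q := by positivity
  rw [e2]
  linarith

end EllipsoidBandit

theorem theorem5 {d : ℕ} [NeZero d] {Ω : Type*} [MeasurableSpace Ω]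
    (μ : Measure Ω) [IsProbabilityMeasure μ]
    (A : Matrix (Fin d) (Fin d) ℝ) (hA : A.PosDef) (c : Fin d → ℝ)
    (σ : ℝ≥0) (hσ : 0 < σ)
    (z : ℕ → Ω → ℝ) (hz_meas : ∀ t, Measurable (z t)) (hz_indep : iIndepFun z μ)
    (hz_mean : ∀ t, ∫ ω, z t ω ∂μ = 0)
    (hz_subG : ∀ t, HasSubgaussianMGF (z t) (σ ^ 2) μ)
    (xs : (Fin d → ℝ) → (Fin d → ℝ))
    (hxs : ∀ v, EllipsoidBandit.IsArgmax (EllipsoidBandit.ellipsoid 0 A) v (xs v))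
    (θ xopt : Fin d → ℝ)
    (hxopt : EllipsoidBandit.IsArgmax (EllipsoidBandit.ellipsoid c A) θ xopt)
    (T : ℕ) :
    Integrable (fun ω => EllipsoidBandit.pathRegret
        (EllipsoidBandit.translatedE2TC c A xs 3 σ T) θ xopt T (fun t => z t ω)) μ ∧
    ∫ ω, EllipsoidBandit.pathRegret
        (EllipsoidBandit.translatedE2TC c A xs 3 σ T) θ xopt T (fun t => z t ω) ∂μ ≤
      7 * d * σ * Real.sqrt T
      + 2622 * (σ : ℝ) ^ 2 * (d : ℝ) ^ 2 / EllipsoidBandit.matNorm A θ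
          * EllipsoidBandit.logBar
              (T * EllipsoidBandit.matNorm A θ ^ 2 / (4 * (σ : ℝ) ^ 2 * (d : ℝ) ^ 2))
      + 2 * T * EllipsoidBandit.matNorm A θ
          * Real.exp
              (min (2 * d / 3 - 1 / 9 * Real.sqrt T * EllipsoidBandit.matNorm A θ / σ) 0)
      + 392 * d * EllipsoidBandit.matNorm A θ :=
  EllipsoidBandit.integral_pathRegret_le μ A hA c σ hσ z hz_meas hz_indep hz_subG xs hxs θ xopt hxopt T
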